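/- Let $k$ be a field of characteristic different from $2$ which is a $C_1$-field, i.e. every homogeneous polynomial over $k$ of positive degree $d$ in $n>d$ variables has a nontrivial zero over $k$. Put $R=k[x]$ and $F=k(x)$. Let $t\in k$ be a non-square, and let $g\in k[x]$ be a monic polynomial of even degree $>1$ with $g(0)=1$. Let $$L=\langle 1,\,-t,\,xt,\,-xg\rangle=Rv_1\perp Rv_2\perp Rv_3\perp Rv_4$$ be the diagonal $R$-lattice with quadratic form $Q$ determined by $Q(v_1)=1$, $Q(v_2)=-t$, $Q(v_3)=xt$, $Q(v_4)=-xg$, and let $V=F\otimes_R L$. For a maximal ideal $\mathfrak p$ of $R$, let $\widehat R_{\mathfrak p}$ be the completion of $R$ at $\mathfrak p$ and $F_{\mathfrak p}$ its fraction field. Then: 1. The quadratic space $V$ over $F$ is universal, i.e. it represents every nonzero element of $F$. 2. $L$ is locally universal at every maximal ideal $\mathfrak p$ of $R$, i.e. $\widehat R_{\mathfrak p}\otimes_R L$ represents every nonzero element of $\widehat R_{\mathfrak p}$. 3. $L$ does not represent $x$ over $R$. Hence the representability of $x$ by $L$ does not satisfy the Hasse principle (the principle that if $x$ is represented by $L$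 over $F$ and over $\widehat R_{\mathfrak p}$ for every maximal ideal $\mathfrak p$ of $R$, then it is represented by $L$ over $R$). 4. The spin group $G=\mathbf{Spin}(V)$ does not satisfy strong approximation over $R$: the diagonal image of $G(F)$ is not dense in the adelic space $G(\mathbf A_F)$, the restricted topological product of the groups $G(F_{\mathfrak p})$ with their $\mathfrak p$-adic topologies, over all maximal ideals $\mathfrak p$ of $R$, with respect to the groups of integral points $G(\widehat R_{\mathfrak p})$ (defined, for all but finitely many $\mathfrak p$, by means of an integral model of $G$ over $R$, on the choice of which the adelic space does not depend). -/

import Mathlib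

open IsDedekindDomain
open scoped Polynomial RestrictedProduct

noncomputable section

/-- A `C₁`-field: every form of positive degree `d` in `n > d` variables has a nontrivial zero. -/
def IsC1Field (k : Type*) [Field k] : Prop :=
  ∀ (n d : ℕ) (f : MvPolynomial (Fin n) k), f.IsHomogeneous d → 0 < d → d < n →
    ∃ z : Fin n → k, z ≠ 0 ∧ MvPolynomial.eval z f = 0

namespace DiagLattice

section Forms

variable {R : Type*} [CommRing R] {ι κ : Type*} [Fintype ι] [Fintype κ]

/-- The quadratic form `∑ aᵢ yᵢ²` of the diagonal lattice `L = ⟨aᵢ⟩ᵢ` over `R`, extended to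
`L ⊗_R A = A^ι`, for an `R`-algebra `A`. -/
def form (a : ι → R) (A : Type*) [CommRing A] [Algebra R A] : QuadraticForm A (ι → A) :=
  QuadraticMap.weightedSumSquares A fun i => algebraMap R A (a i)

/-- `L ⊗_R A` is universal: it represents all the nonzero elements of `A`. -/
def IsUniversalOver (a : ι → R) (A : Type*) [CommRing A] [Algebra R A] : Prop :=
  ∀ c : A, c ≠ 0 → ∃ y : ι → A, form a A y = c

/-- The diagonal lattice `M = ⟨bⱼ⟩ⱼ` is represented by `L = ⟨aᵢ⟩ᵢ` over `A`: there is an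
`A`-linear map `σ : M ⊗_R A → L ⊗_R A` compatible with the quadratic forms. -/
def RepresentedOver (b : κ → R) (a : ι → R) (A : Type*) [CommRing A] [Algebra R A] : Prop :=
  Nonempty (form b A →qᵢ form a A)

/-- A ring element `c` of `R` is represented by `L` over `A`: the lattice `Rv` with `Q(v) = c` is
represented by `L` over `A`. -/
def RepresentsOver (a : ι → R) (c : R) (A : Type*) [CommRing A] [Algebra R A] : Prop :=
  RepresentedOver (fun _ : Unit => c) a A

variable (A B : Type*) [CommRing A] [Algebra R A] [CommRing B] [Algebra R B]
  [Algebra A B] [IsScalarTower R A B]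

/-- Coordinatewise extension of scalars `A^ι → B^ι`. -/
def vecMap (ι : Type*) : (ι → A) →ₗ[A] (ι → B) where
  toFun y i := algebraMap A B (y i)
  map_add' y z := by ext i; simp
  map_smul' c y := by ext i; simp [Algebra.smul_def]

theorem form_vecMap (a : ι → R) (y : ι → A) :
    form a B (vecMap A B ι y) = algebraMap A B (form a A y) := by
  simp [form, vecMap, QuadraticMap.weightedSumSquares_apply, ← IsScalarTower.algebraMap_apply]

/-- Extension of scalars for Clifford algebras, `C(L ⊗_R A) → C(L ⊗_R B)`. -/
def cliffordMap (a : ι → R) : CliffordAlgebra (form a A) →ₐ[A] CliffordAlgebra (form a B) :=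
  CliffordAlgebra.lift (form a A)
    ⟨(CliffordAlgebra.ι (form a B)).restrictScalars A ∘ₗ vecMap A B ι, fun y => by
      simp [CliffordAlgebra.ι_sq_scalar, form_vecMap,
        IsScalarTower.algebraMap_apply A B (CliffordAlgebra (form a B))]⟩

@[simp]
theorem cliffordMap_ι (a : ι → R) (y : ι → A) :
    cliffordMap A B a (CliffordAlgebra.ι (form a A) y) =
      CliffordAlgebra.ι (form a B) (vecMap A B ι y) := by
  simp [cliffordMap]

theorem star_cliffordMap (a : ι → R) (z : CliffordAlgebra (form a A)) :
    star (cliffordMap A B a z) = cliffordMap A B a (star z) := by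
  induction z using CliffordAlgebra.induction with
  | algebraMap r =>
    rw [AlgHom.commutes, CliffordAlgebra.star_algebraMap, AlgHom.commutes,
      IsScalarTower.algebraMap_apply A B (CliffordAlgebra (form a B)),
      CliffordAlgebra.star_algebraMap]
  | ι x => simp [CliffordAlgebra.star_ι]
  | mul x y hx hy => simp [hx, hy]
  | add x y hx hy => simp [hx, hy]

theorem cliffordMap_mem_even (a : ι → R) {z : CliffordAlgebra (form a A)}
    (hz : z ∈ CliffordAlgebra.even (form a A)) :
    cliffordMap A B a z ∈ CliffordAlgebra.even (form a B) := by
  induction z, hz using CliffordAlgebra.even_induction with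
  | algebraMap r =>
    rw [AlgHom.commutes, IsScalarTower.algebraMap_apply A B (CliffordAlgebra (form a B))]
    exact Subalgebra.algebraMap_mem _ _
  | add x y hx hy ihx ihy => rw [map_add]; exact add_mem ihx ihy
  | ι_mul_ι_mul m₁ m₂ x hx ih =>
    rw [map_mul, map_mul, cliffordMap_ι, cliffordMap_ι]
    exact mul_mem (CliffordAlgebra.ι_mul_ι_mem_evenOdd_zero _ _ _) ih

theorem cliffordMap_mem_lipschitzGroup (a : ι → R) {u : (CliffordAlgebra (form a A))ˣ}
    (hu : u ∈ lipschitzGroup (form a A)) :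
    Units.map (cliffordMap A B a : _ →* _) u ∈ lipschitzGroup (form a B) := by
  induction hu using Subgroup.closure_induction with
  | mem u hu =>
    obtain ⟨y, hy⟩ := hu
    exact Subgroup.subset_closure ⟨vecMap A B ι y, by simp [← hy]⟩
  | one => rw [map_one]; exact one_mem _
  | mul u v _ _ hu hv => rw [map_mul]; exact mul_mem hu hv
  | inv u _ hu => rw [map_inv]; exact inv_mem hu

theorem cliffordMap_mem_spinGroup (a : ι → R) {z : CliffordAlgebra (form a A)}
    (hz : z ∈ spinGroup (form a A)) : cliffordMap A B a z ∈ spinGroup (form a B) := by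
  obtain ⟨⟨⟨u, hu, rfl⟩, hstar⟩, heven⟩ := hz
  refine ⟨⟨⟨_, cliffordMap_mem_lipschitzGroup A B a hu, rfl⟩, ?_⟩,
    cliffordMap_mem_even A B a heven⟩
  rw [SetLike.mem_coe, Unitary.mem_iff] at hstar ⊢
  rw [star_cliffordMap, ← map_mul, ← map_mul]
  exact ⟨(congrArg _ hstar.1).trans (map_one _), (congrArg _ hstar.2).trans (map_one _)⟩

end Forms

section Adelic

variable {R : Type*} [CommRing R] [IsDedekindDomain R] {ι : Type*} [Fintype ι]
  (F : Type*) [Field F] [Algebra R F] [IsFractionRing R F]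

/-- The group `Spin(V)(F)`, where `V = FL` (for a nondegenerate `V` in characteristic `≠ 2`). -/
def RationalSpin (a : ι → R) : Type _ := spinGroup (form a F)

/-- The group `Spin(V)(F_v)`, where `V = FL` and `F_v` is the completion of `F` at `v`. -/
def LocalSpin (a : ι → R) (v : HeightOneSpectrum R) : Type _ :=
  spinGroup (form a (v.adicCompletion F))

/-- The `v`-adic topology on `Spin(V)(F_v)`: the subspace topology for the canonical topology of the
finite-dimensional `F_v`-vector space `C(V_v)`. -/
instance instTopologicalSpaceLocalSpin (a : ι → R) (v : HeightOneSpectrum R) : TopologicalSpace (LocalSpin F a v) :=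
  .induced Subtype.val
    (moduleTopology (v.adicCompletion F) (CliffordAlgebra (form a (v.adicCompletion F))))

/-- The integral points of `Spin(V)` at `v`: the elements of `Spin(V)(F_v)` lying in the `R_v`-lattice
`C(L_v)` of `C(V_v)`, where `R_v` is the ring of integers of `F_v`. These are the `R_v`-points of the
integral model of `Spin(V)` over `R` that is the schematic closure of `Spin(V)` in the
affine space over `R` attached to the lattice `C(L)`. -/
def integralSpin (a : ι → R) (v : HeightOneSpectrum R) : Set (LocalSpin F a v) :=
  {γ | γ.1 ∈ Set.range (cliffordMap (v.adicCompletionIntegers F) (v.adicCompletion F) a)}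

/-- The adelic space `Spin(V)(𝔸_F)` over `R`: the restricted product of the groups `Spin(V)(F_v)`
with respect to their integral points, with its restricted product topology. -/
abbrev AdelicSpin (a : ι → R) : Type _ :=
  Πʳ v : HeightOneSpectrum R, [LocalSpin F a v, integralSpin F a v]

theorem cliffordMap_mem_integral (a : ι → R) (z : CliffordAlgebra (form a F)) :
    ∀ᶠ v : HeightOneSpectrum R in Filter.cofinite, cliffordMap F (v.adicCompletion F) a z ∈
      Set.range (cliffordMap (v.adicCompletionIntegers F) (v.adicCompletion F) a) := by
  have key (c : F) : ∀ᶠ v : HeightOneSpectrum R in Filter.cofinite,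
      ∃ d : v.adicCompletionIntegers F, (d : v.adicCompletion F) = algebraMap F _ c := by
    filter_upwards [(HeightOneSpectrum.Support.finite R c).compl_mem_cofinite] with v hv
    refine ⟨⟨algebraMap F _ c, ?_⟩, rfl⟩
    rw [HeightOneSpectrum.mem_adicCompletionIntegers]
    exact (HeightOneSpectrum.valuedAdicCompletion_eq_valuation' v c).le.trans (not_lt.1 hv)
  induction z using CliffordAlgebra.induction with
  | algebraMap r =>
    filter_upwards [key r] with v ⟨d, hd⟩
    refine ⟨algebraMap _ _ d, ?_⟩
    rw [AlgHom.commutes, AlgHom.commutes,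
      IsScalarTower.algebraMap_apply F (v.adicCompletion F) (CliffordAlgebra _), ← hd]
    rfl
  | ι x =>
    filter_upwards [Filter.eventually_all.2 fun i => key (x i)] with v hv
    choose d hd using hv
    refine ⟨CliffordAlgebra.ι _ d, ?_⟩
    rw [cliffordMap_ι, cliffordMap_ι]
    congr 1
    funext i
    exact hd i
  | mul x y hx hy =>
    filter_upwards [hx, hy] with v ⟨x', hx'⟩ ⟨y', hy'⟩
    exact ⟨x' * y', by rw [map_mul, map_mul, hx', hy']⟩
  | add x y hx hy =>
    filter_upwards [hx, hy] with v ⟨x', hx'⟩ ⟨y', hy'⟩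
    exact ⟨x' + y', by rw [map_add, map_add, hx', hy']⟩

/-- The diagonal map `Spin(V)(F) → Spin(V)(𝔸_F)`. -/
def diagonal (a : ι → R) (γ : RationalSpin F a) : AdelicSpin F a :=
  ⟨fun v => ⟨cliffordMap F (v.adicCompletion F) a γ.1,
      cliffordMap_mem_spinGroup F (v.adicCompletion F) a γ.2⟩,
    cliffordMap_mem_integral F a γ.1⟩

/-- `Spin(V)` satisfies strong approximation over `R`. -/
def SpinStrongApproximation (a : ι → R) : Prop :=
  DenseRange (diagonal F a)

/-- `L` is locally universal at `v`: `L_v` represents all the nonzero elements of the completion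
of `R` at `v`. -/
def IsLocallyUniversalAt (a : ι → R) (v : HeightOneSpectrum R) : Prop :=
  IsUniversalOver a (v.adicCompletionIntegers F)

/-- The Hasse principle for the representability `M → L`. -/
def HassePrinciple {κ : Type*} [Fintype κ] (b : κ → R) (a : ι → R) : Prop :=
  (RepresentedOver b a F ∧
      ∀ v : HeightOneSpectrum R, RepresentedOver b a (v.adicCompletionIntegers F)) →
    RepresentedOver b a R

end Adelic

end DiagLattice

end

noncomputable section

/-! ### Systems of quadratic forms over a C₁-field. -/

section C1Fields

variable {k : Type*} [Field k]

/-! The positive statements rest on counting variables. By the Artin–Lang–Nagata argument, over a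
C₁-field with a non-square, `r` quadratic forms in more than `2r` variables have a common nontrivial
zero. Expanding vectors in coordinates over `k` shows that quinary forms over `k(x)` and ternary
forms over residue fields are isotropic. The former makes `V` universal. The latter, with Hensel's
lemma, makes binary unimodular forms over the completions represent all units. Away from `x` the
plane `⟨1,-t⟩`, helped by `xt` for non-units, suffices; at `x` the planes `⟨1,-t⟩` and `x⟨t,-g⟩`
cover even and odd orders, as `g(0) = 1`.

The negative statements rest on parity of degrees. As `t` is not a square, leading terms never
cancel in `a² - t b²`, nor when one square is multiplied by the monic `g` of even degree, so such
values have even degree. A factor `x` makes degrees odd, which excludes the representation of `x`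
(`Polynomial.not_represents_X`).

The same parity obstructs strong approximation. If a rational spin element is integral everywhere,
the image `y` of `v₁` has polynomial inner products with all `vⱼ`, and `Q(y) = 1` then forces `y` to
be orthogonal to `v₃` (`Polynomial.eq_zero_of_form_eq_one`). But at the place `x` there is an
integral rotation in the plane of `v₁, v₃` for which this inner product has order exactly one. Hence
the open set of adelic points integral everywhere and congruent to this rotation modulo `x²`
contains no rational point. -/

theorem IsC1Field.exists_zero (hk : IsC1Field k) {ι : Type*} [Fintype ι] {d : ℕ}
    {f : MvPolynomial ι k} (hf : f.IsHomogeneous d) (hd : 0 < d) (hdι : d < Fintype.card ι) :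
    ∃ z : ι → k, z ≠ 0 ∧ MvPolynomial.eval z f = 0 := by
  let e := Fintype.equivFin ι
  obtain ⟨z, hz, hfz⟩ := hk _ d (MvPolynomial.rename e f)
    (hf.rename_isHomogeneous) hd hdι
  refine ⟨z ∘ e, fun h => hz ?_, by rwa [MvPolynomial.eval_rename] at hfz⟩
  funext i
  simpa using congrFun h (e.symm i)

/-- Only the trivial zero of `a² - t b²` when `t` is not a square. -/
theorem eq_zero_of_sq_sub_mul_sq {t : k} (ht : ¬ IsSquare t) {a b : k}
    (h : a ^ 2 - t * b ^ 2 = 0) : a = 0 ∧ b = 0 := by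
  have hb : b = 0 := by
    by_contra hb
    exact ht ⟨a / b, by field_simp; linear_combination -h⟩
  subst hb
  simpa using h

/-- Iterating the anisotropic norm form, `φ(u)² - t φ(w)²` doubles both the degree and the number of
variables. This yields normic forms of arbitrarily large degree, as needed to combine many equations
into one. -/
theorem exists_normic_form {t : k} (ht : ¬ IsSquare t) (m : ℕ) :
    ∃ (ι : Type) (_ : Fintype ι) (φ : MvPolynomial ι k), Fintype.card ι = 2 ^ m ∧
      φ.IsHomogeneous (2 ^ m) ∧ ∀ z, MvPolynomial.eval z φ = 0 → z = 0 := by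
  induction m with
  | zero =>
    refine ⟨Unit, inferInstance, MvPolynomial.X (), by simp, MvPolynomial.isHomogeneous_X _ _,
      fun z hz => ?_⟩
    funext i
    simpa using hz
  | succ m ih =>
    obtain ⟨ι, _, φ, hcard, hφ, h0⟩ := ih
    refine ⟨ι ⊕ ι, inferInstance, MvPolynomial.rename Sum.inl φ ^ 2 -
      MvPolynomial.C t * MvPolynomial.rename Sum.inr φ ^ 2, by simp [hcard]; ring, ?_, ?_⟩
    · rw [pow_succ]
      exact (hφ.rename_isHomogeneous.pow 2).sub ((hφ.rename_isHomogeneous.pow 2).C_mul _)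
    · intro z hz
      simp only [map_sub, map_mul, map_pow, MvPolynomial.eval_C, MvPolynomial.eval_rename] at hz
      obtain ⟨h1, h2⟩ := eq_zero_of_sq_sub_mul_sq ht hz
      funext i
      rcases i with i | i
      · exact congrFun (h0 _ h1) i
      · exact congrFun (h0 _ h2) i

/-- Over a `C₁`-field that is not quadratically closed, `r` quadratic forms in more than `2r`
variables have a common nontrivial zero. -/
theorem IsC1Field.exists_common_zero (hk : IsC1Field k) {t : k} (ht : ¬ IsSquare t)
    {σ ρ : Type*} [Fintype σ] [Fintype ρ] (f : ρ → MvPolynomial σ k)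
    (hf : ∀ s, (f s).IsHomogeneous 2) (hcard : 2 * Fintype.card ρ < Fintype.card σ) :
    ∃ z : σ → k, z ≠ 0 ∧ ∀ s, MvPolynomial.eval z (f s) = 0 := by
  classical
  rcases isEmpty_or_nonempty ρ with hρ | hρ
  · have : Nonempty σ := Fintype.card_pos_iff.1 (by omega)
    exact ⟨1, one_ne_zero, fun s => isEmptyElim s⟩
  set r := Fintype.card ρ with hr
  have hr0 : 0 < r := Fintype.card_pos
  -- Large enough to force `q > 2r + 1` below; this absorbs the loss from rounding `2 ^ m / r` down.
  let m := r * (2 * r + 1)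
  obtain ⟨ι, _, φ, hι, hφ, h0⟩ := exists_normic_form ht m
  set q := 2 ^ m / r with hq
  have hm : r * (2 * r + 1) < 2 ^ m := Nat.lt_two_pow_self
  have hqr : 2 ^ m < r * q + r := by
    have := Nat.div_add_mod (2 ^ m) r
    have := Nat.mod_lt (2 ^ m) hr0
    rw [hq]; omega
  obtain ⟨e⟩ : Nonempty (Fin q × ρ ↪ ι) := by
    rw [Function.Embedding.nonempty_iff_card_le]
    simp only [Fintype.card_prod, Fintype.card_fin, hι, ← hr]
    exact Nat.div_mul_le_self _ _
  -- The slots of `φ` are filled with `q` copies of the system in disjoint sets of variables, and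
  -- the slots left over with `0`. Anisotropy of `φ` then makes a zero of the composite a zero of
  -- every copy, and some copy of the variables is nonzero.
  let G : ι → MvPolynomial (Fin q × σ) k := fun i =>
    if h : ∃ p, e p = i then MvPolynomial.rename (Prod.mk h.choose.1) (f h.choose.2) else 0
  have hGe (j : Fin q) (s : ρ) : G (e (j, s)) = MvPolynomial.rename (Prod.mk j) (f s) := by
    have h : ∃ p, e p = e (j, s) := ⟨_, rfl⟩
    have h' : h.choose = (j, s) := e.injective h.choose_spec
    simp only [G, dif_pos h]
    rw [h']
  have hG (i) : (G i).IsHomogeneous 2 := by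
    simp only [G]
    split_ifs with h
    · exact (hf _).rename_isHomogeneous
    · exact MvPolynomial.isHomogeneous_zero _ _ _
  obtain ⟨z, hz, hGz⟩ := hk.exists_zero (hφ.aeval G hG) (by positivity) (by
    simp only [Fintype.card_prod, Fintype.card_fin]
    have h1 : q * (2 * r + 1) ≤ q * Fintype.card σ := Nat.mul_le_mul_left _ hcard
    have h2 : 2 * r + 1 < q := by
      by_contra h
      push Not at h
      have h3 : r * q ≤ r * (2 * r + 1) := Nat.mul_le_mul_left _ h
      have hm2 : r * (2 * r + 1) + r ≤ 2 ^ m := by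
        calc r * (2 * r + 1) + r ≤ 2 * m := by simp only [m]; nlinarith
          _ ≤ 2 ^ m := by
            have h5 : 1 ≤ m := by simp only [m]; nlinarith
            obtain ⟨l, hl⟩ : ∃ l, m = l + 1 := ⟨m - 1, by omega⟩
            rw [hl, pow_succ, mul_comm]
            exact Nat.mul_le_mul_right _ Nat.lt_two_pow_self
      omega
    nlinarith)
  have hφz : ∀ i, MvPolynomial.eval z (G i) = 0 := by
    refine congrFun (h0 (fun i => MvPolynomial.eval z (G i)) ?_)
    rw [← hGz, ← MvPolynomial.coe_aeval_eq_eval, ← MvPolynomial.coe_aeval_eq_eval]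
    exact (MvPolynomial.comp_aeval_apply G (MvPolynomial.aeval z) φ).symm
  obtain ⟨⟨j, i⟩, hji⟩ := Function.ne_iff.1 hz
  refine ⟨fun i => z (j, i), fun h => hji (congrFun h i), fun s => ?_⟩
  have := hφz (e (j, s))
  rw [hGe, MvPolynomial.eval_rename] at this
  exact this

/-- Over a `k`-algebra `A`, the values of a diagonal form on vectors with entries in a fixed
finite-dimensional subspace can be made to vanish under few enough functionals. -/
theorem IsC1Field.exists_sum_mul_sq (hk : IsC1Field k) {t : k} (ht : ¬ IsSquare t)
    {A : Type*} [CommRing A] [Algebra k A] {ι κ ρ : Type*} [Fintype ι] [Fintype κ] [Fintype ρ]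
    (c : ι → A) {b : κ → A} (hb : LinearIndependent k b) (l : ρ → A →ₗ[k] k)
    (hcard : 2 * Fintype.card ρ < Fintype.card ι * Fintype.card κ) :
    ∃ y : ι → A, y ≠ 0 ∧ (∀ i, y i ∈ Submodule.span k (Set.range b)) ∧
      ∀ s, l s (∑ i, c i * y i ^ 2) = 0 := by
  let f : ρ → MvPolynomial (ι × κ) k := fun s => ∑ i, ∑ j, ∑ j',
    MvPolynomial.C (l s (c i * (b j * b j'))) * (MvPolynomial.X (i, j) * MvPolynomial.X (i, j'))
  obtain ⟨z, hz, hfz⟩ := hk.exists_common_zero ht f (fun s => by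
    refine .sum _ _ _ fun i _ => .sum _ _ _ fun j _ => .sum _ _ _ fun j' _ => ?_
    exact ((MvPolynomial.isHomogeneous_X _ _).mul (MvPolynomial.isHomogeneous_X _ _)).C_mul _)
    (by simpa using hcard)
  refine ⟨fun i => ∑ j, z (i, j) • b j, fun h => hz ?_, fun i => ?_, fun s => ?_⟩
  · funext ⟨i, j⟩
    exact Fintype.linearIndependent_iff.1 hb _ (congrFun h i) j
  · exact Submodule.sum_mem _ fun j _ => Submodule.smul_mem _ _ (Submodule.subset_span ⟨j, rfl⟩)
  · rw [← hfz s]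
    simp only [f, map_sum, map_mul, MvPolynomial.eval_C, MvPolynomial.eval_X, sq,
      Finset.sum_mul_sum]
    refine Finset.sum_congr rfl fun i _ => ?_
    simp only [Finset.mul_sum, map_sum]
    refine Finset.sum_congr rfl fun j _ => Finset.sum_congr rfl fun j' _ => ?_
    rw [smul_mul_smul_comm, mul_smul_comm, map_smul, smul_eq_mul]
    ring

/-- Quinary diagonal forms over `k[x]` are isotropic. -/
theorem IsC1Field.polynomial_isotropic (hk : IsC1Field k) {t : k} (ht : ¬ IsSquare t)
    {ι : Type*} [Fintype ι] (hι : 5 ≤ Fintype.card ι) (c : ι → k[X]) :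
    ∃ y : ι → k[X], y ≠ 0 ∧ ∑ i, c i * y i ^ 2 = 0 := by
  let D := Finset.univ.sup fun i => (c i).natDegree
  have hD (i) : (c i).natDegree ≤ D := Finset.le_sup (f := fun i => (c i).natDegree) (by simp)
  -- Entries of degree at most `2D` give at least `5(2D+1)` unknowns, while the value has degree at
  -- most `5D`, hence `5D+1` coefficients; and `10D+2 < 10D+5`.
  let b : Fin (2 * D + 1) → k[X] := fun j => Polynomial.basisMonomials k j
  obtain ⟨y, hy, hspan, h⟩ := hk.exists_sum_mul_sq ht c (b := b)
    ((Polynomial.basisMonomials k).linearIndependent.comp _ Fin.val_injective)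
    (fun s : Fin (5 * D + 1) => Polynomial.lcoeff k s) (by simp; nlinarith)
  have hdeg (i) : (y i).natDegree ≤ 2 * D := by
    have : Submodule.span k (Set.range b) ≤ Polynomial.degreeLE k (2 * D : ℕ) := by
      rw [Submodule.span_le]
      rintro _ ⟨j, rfl⟩
      rw [SetLike.mem_coe, Polynomial.mem_degreeLE]
      simp only [b, Polynomial.coe_basisMonomials]
      exact (Polynomial.degree_monomial_le _ _).trans (by exact_mod_cast Nat.lt_succ_iff.1 j.2)
    exact Polynomial.natDegree_le_of_degree_le (Polynomial.mem_degreeLE.1 (this (hspan i)))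
  refine ⟨y, hy, Polynomial.ext fun s => ?_⟩
  rw [Polynomial.coeff_zero]
  by_cases hs : s < 5 * D + 1
  · exact h ⟨s, hs⟩
  · refine Polynomial.coeff_eq_zero_of_natDegree_lt (lt_of_le_of_lt (b := 5 * D) ?_ (by omega))
    refine Polynomial.natDegree_sum_le_of_forall_le _ _ fun i _ => ?_
    refine Polynomial.natDegree_mul_le.trans ?_
    have := (Polynomial.natDegree_pow_le (p := y i) (n := 2))
    have := hD i
    have := hdeg i
    omega

/-- Quinary diagonal forms over `k(x)` are isotropic. -/
theorem IsC1Field.fractionRing_isotropic (hk : IsC1Field k) {t : k} (ht : ¬ IsSquare t)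
    {F : Type*} [Field F] [Algebra k[X] F] [IsFractionRing k[X] F]
    {ι : Type*} [Fintype ι] (hι : 5 ≤ Fintype.card ι) (c : ι → F) :
    ∃ y : ι → F, y ≠ 0 ∧ ∑ i, c i * y i ^ 2 = 0 := by
  obtain ⟨d, hd⟩ := IsLocalization.exist_integer_multiples_of_finite (nonZeroDivisors k[X]) c
  choose c' hc' using hd
  obtain ⟨y, hy, h⟩ := hk.polynomial_isotropic ht hι c'
  have hinj := IsFractionRing.injective k[X] F
  refine ⟨fun i => algebraMap _ _ (y i), fun h0 => hy ?_, ?_⟩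
  · funext i
    exact hinj (by simpa using congrFun h0 i)
  · have hd0 : algebraMap k[X] F d ≠ 0 := by
      simp
    refine (mul_eq_zero.1 ?_).resolve_left hd0
    rw [← map_zero (algebraMap k[X] F), ← h, map_sum, Finset.mul_sum]
    refine Finset.sum_congr rfl fun i _ => ?_
    rw [map_mul, hc', Algebra.smul_def, map_pow]
    ring

/-- Ternary diagonal forms over a finite extension of a `C₁`-field are isotropic. -/
theorem IsC1Field.finite_isotropic (hk : IsC1Field k) {t : k} (ht : ¬ IsSquare t)
    {K : Type*} [Field K] [Algebra k K] [Module.Finite k K]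
    {ι : Type*} [Fintype ι] (hι : 3 ≤ Fintype.card ι) (c : ι → K) :
    ∃ y : ι → K, y ≠ 0 ∧ ∑ i, c i * y i ^ 2 = 0 := by
  let b := Module.finBasis k K
  obtain ⟨y, hy, -, h⟩ := hk.exists_sum_mul_sq ht c b.linearIndependent b.coord (by
    have := Module.finrank_pos (R := k) (M := K)
    simp only [Fintype.card_fin]
    nlinarith)
  exact ⟨y, hy, b.forall_coord_eq_zero_iff.1 h⟩

end C1Fields

/-- If diagonal forms in one more variable are isotropic, a nondegenerate diagonal form is
universal. -/
theorem exists_sum_mul_sq_eq {K : Type*} [Field K] (h2 : (2 : K) ≠ 0) {ι : Type*} [Fintype ι]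
    (h : ∀ c : Option ι → K, ∃ y : Option ι → K, y ≠ 0 ∧ ∑ i, c i * y i ^ 2 = 0)
    (a : ι → K) (ha : ∀ i, a i ≠ 0) (u : K) :
    ∃ y : ι → K, ∑ i, a i * y i ^ 2 = u := by
  classical
  obtain ⟨y, hy, hy0⟩ := h fun o => o.elim (-u) a
  rw [Fintype.sum_option] at hy0
  simp only [Option.elim] at hy0
  by_cases hn : y none = 0
  · obtain ⟨i, hi⟩ : ∃ i, y (some i) ≠ 0 := by
      by_contra! h0
      exact hy (funext fun o => by cases o <;> simp [hn, h0])
    -- Here the form itself has an isotropic vector `y`. The value at `s y + eᵢ` is `2 s aᵢ yᵢ +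
    -- aᵢ`, affine in `s`, and this `s` makes it `u`.
    let s := (u - a i) / (2 * a i * y (some i))
    refine ⟨fun j => s * y (some j) + if j = i then 1 else 0, ?_⟩
    have : ∀ j, a j * (s * y (some j) + if j = i then 1 else 0) ^ 2 =
        s ^ 2 * (a j * y (some j) ^ 2) +
          if j = i then 2 * s * a j * y (some j) + a j else 0 := by
      intro j
      split_ifs <;> ring
    simp only [this, Finset.sum_add_distrib, ← Finset.mul_sum, Finset.sum_ite_eq',
      Finset.mem_univ, if_true]
    rw [hn] at hy0
    have h0 : ∑ j, a j * y (some j) ^ 2 = 0 := by simpa using hy0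
    have := ha i
    rw [h0]
    simp only [s]
    field_simp
    ring
  · refine ⟨fun j => y (some j) / y none, ?_⟩
    simp only [div_pow, mul_div_assoc', ← Finset.sum_div]
    rw [div_eq_iff (pow_ne_zero 2 hn)]
    linear_combination hy0

/-! ### Square roots in complete valued fields. -/

section Valued

open Filter Topology

theorem Valued.nonarchimedeanAddGroup (K : Type*) {Γ₀ : Type*} [Field K]
    [LinearOrderedCommGroupWithZero Γ₀] [hv : Valued K Γ₀] : NonarchimedeanAddGroup K where
  is_nonarchimedean U hU := by
    obtain ⟨γ, hγ⟩ := Valued.mem_nhds_zero.1 hU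
    exact ⟨⟨hv.v.restrict.ltAddSubgroup γ, Valued.isOpen_ball K _⟩, hγ⟩

/-- In a complete valued field with `2` a unit, `1 + a` is a square when `a` is small. -/
theorem Valued.exists_sq_eq_one_add {K Γ₀ : Type*} [Field K] [LinearOrderedCommGroupWithZero Γ₀]
    [MulArchimedean Γ₀] [hv : Valued K Γ₀] [CompleteSpace K] [T0Space K]
    (h2 : hv.v (2 : K) = 1) {a : K} (ha : hv.v a < 1) : ∃ z : K, z ^ 2 = 1 + a := by
  have h20 : (2 : K) ≠ 0 := (Valuation.ne_zero_iff hv.v).1 (by rw [h2]; exact one_ne_zero)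
  -- A fixed point of `y ↦ (a - y²)/2` satisfies `(1 + y)² = 1 + a`. The map contracts by the factor
  -- `v a` on elements of value at most `v a`.
  let y : ℕ → K := fun n => Nat.rec 0 (fun _ y => (a - y ^ 2) / 2) n
  have hy (n) : y (n + 1) = (a - y n ^ 2) / 2 := rfl
  have hya (n) : hv.v (y n) ≤ hv.v a := by
    induction n with
    | zero => simp [y]
    | succ n ih =>
      rw [hy, map_div₀, h2, div_one]
      refine (hv.v.map_sub _ _).trans (max_le le_rfl ?_)
      rw [map_pow, sq]
      exact (mul_le_of_le_one_right' (ih.trans ha.le)).trans ih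
  have hd (n) : hv.v (y (n + 1) - y n) ≤ hv.v (a ^ n) := by
    induction n with
    | zero =>
      rw [pow_zero, map_one]
      exact (hv.v.map_sub _ _).trans (max_le ((hya (0 + 1)).trans ha.le) ((hya 0).trans ha.le))
    | succ n ih =>
      have : y (n + 1 + 1) - y (n + 1) = -((y (n + 1) - y n) * (y (n + 1) + y n)) / 2 := by
        rw [hy (n + 1), hy n]
        ring
      rw [this, map_div₀, h2, div_one, Valuation.map_neg, map_mul, pow_succ, map_mul]
      exact mul_le_mul' ih ((hv.v.map_add _ _).trans (max_le (hya (n + 1)) (hya n)))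
  have hlim : Tendsto (fun n => y (n + 1) - y n) atTop (𝓝 0) := by
    rw [(Valued.hasBasis_nhds_zero K Γ₀).tendsto_right_iff]
    intro γ _
    have := (Valued.hasBasis_nhds_zero K Γ₀).tendsto_right_iff.1
      (Valued.tendsto_zero_pow_of_v_lt_one ha) γ trivial
    filter_upwards [this] with n hn
    exact ((Valuation.restrict_le_iff hv.v).2 (hd n)).trans_lt hn
  have := Valued.nonarchimedeanAddGroup K (Γ₀ := Γ₀)
  obtain ⟨z, hz⟩ := cauchySeq_tendsto_of_complete
    (NonarchimedeanAddGroup.cauchySeq_of_tendsto_sub_nhds_zero hlim)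
  have h1 : Tendsto (fun n => y (n + 1)) atTop (𝓝 ((a - z ^ 2) / 2)) := by
    simp only [hy, div_eq_mul_inv]
    exact (tendsto_const_nhds.sub (hz.pow 2)).mul tendsto_const_nhds
  have h3 := tendsto_nhds_unique h1 (hz.comp (tendsto_add_atTop_nat 1))
  refine ⟨1 + z, ?_⟩
  rw [div_eq_iff h20] at h3
  linear_combination -h3

end Valued

/-! ### Completions: residues and values of binary unimodular forms. -/

namespace IsDedekindDomain.HeightOneSpectrum

variable {R : Type*} [CommRing R] [IsDedekindDomain R] (F : Type*) [Field F] [Algebra R F]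
  [IsFractionRing R F] (v : HeightOneSpectrum R)

open IsLocalRing

theorem valued_algebraMap_adicCompletion (r : R) :
    Valued.v (algebraMap R (v.adicCompletion F) r) = v.valuation F (algebraMap R F r) :=
  valuedAdicCompletion_eq_valuation' v (algebraMap R F r)

variable {F} in
theorem mem_maximalIdeal_adicCompletionIntegers_iff {c : v.adicCompletionIntegers F} :
    c ∈ maximalIdeal (v.adicCompletionIntegers F) ↔ Valued.v (c : v.adicCompletion F) < 1 := by
  rw [mem_maximalIdeal, mem_nonunits_iff, adicCompletionIntegers.isUnit_iff_valued_eq_one]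
  exact ⟨fun h => lt_of_le_of_ne c.2 h, fun h => h.ne⟩

theorem algebraMap_mem_maximalIdeal_iff {r : R} :
    algebraMap R (v.adicCompletionIntegers F) r ∈ maximalIdeal (v.adicCompletionIntegers F) ↔
      r ∈ v.asIdeal := by
  rw [mem_maximalIdeal_adicCompletionIntegers_iff, ← valuation_lt_one_iff_mem (K := F)]
  exact iff_of_eq (congrArg (· < 1) (valued_algebraMap_adicCompletion F v r))

theorem isUnit_algebraMap_iff {r : R} :
    IsUnit (algebraMap R (v.adicCompletionIntegers F) r) ↔ r ∉ v.asIdeal := by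
  rw [← algebraMap_mem_maximalIdeal_iff F v, mem_maximalIdeal, mem_nonunits_iff, not_not]

variable {F} in
-- Density of `F` first gives an approximation in `F`, necessarily `v`-integral, which is then
-- approximated by an element of `R`. Thus residues of the completion already come from `R`.
theorem exists_sub_algebraMap_mem_maximalIdeal (c : v.adicCompletionIntegers F) :
    ∃ r : R, c - algebraMap R _ r ∈ maximalIdeal (v.adicCompletionIntegers F) := by
  have hU : {y : v.adicCompletion F | Valued.v (y - c) < 1} ∈ nhds (c : v.adicCompletion F) := by
    rw [Valued.mem_nhds]
    exact ⟨1, fun y hy => (Valuation.restrict_lt_one_iff _).1 hy⟩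
  obtain ⟨x, hx⟩ := (denseRange_algebraMap F v).exists_mem_open isOpen_interior
    ⟨(c : v.adicCompletion F), mem_interior_iff_mem_nhds.2 hU⟩
  have hx' := interior_subset hx
  replace hx : Valued.v (algebraMap F (v.adicCompletion F) x - c) < 1 := hx'
  have hx1 : v.valuation F x ≤ 1 := by
    rw [← valuedAdicCompletion_eq_valuation' v x]
    have : algebraMap F (v.adicCompletion F) x =
      (algebraMap F (v.adicCompletion F) x - c) + c := by ring
    change Valued.v (algebraMap F (v.adicCompletion F) x) ≤ 1
    rw [this]
    exact (Valuation.map_add _ _ _).trans (max_le hx.le c.2)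
  obtain ⟨r, hr⟩ := v.exists_valuation_sub_lt_of_integer hx1 1
  refine ⟨r, (mem_maximalIdeal_adicCompletionIntegers_iff v).2 ?_⟩
  rw [← valuedAdicCompletion_eq_valuation' v] at hr
  have : ((c - algebraMap R _ r : v.adicCompletionIntegers F) : v.adicCompletion F) =
      -((algebraMap F (v.adicCompletion F) x - c) +
        algebraMap F (v.adicCompletion F) (algebraMap R F r - x)) := by
    rw [map_sub]
    push_cast
    rw [algebraMap_adicCompletionIntegers_apply]
    change (c : v.adicCompletion F) - algebraMap F _ (algebraMap R F r) = _
    ring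
  rw [this, Valuation.map_neg]
  exact (Valuation.map_add _ _ _).trans_lt (max_lt hx hr)

variable {F v} in
/-- Hensel's lemma for square roots. -/
theorem exists_sq_eq_of_sub_mem_maximalIdeal (h2 : (2 : R) ∉ v.asIdeal)
    {u w : v.adicCompletionIntegers F} (hw : IsUnit w)
    (huw : u - w ^ 2 ∈ maximalIdeal (v.adicCompletionIntegers F)) :
    ∃ z : v.adicCompletionIntegers F, z ^ 2 = u := by
  obtain ⟨w, rfl⟩ := hw
  have h2' : Valued.v (2 : v.adicCompletion F) = 1 := by
    have := (isUnit_algebraMap_iff F v).2 h2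
    rwa [map_ofNat, adicCompletionIntegers.isUnit_iff_valued_eq_one] at this
  let e : v.adicCompletionIntegers F := (↑w⁻¹ : v.adicCompletionIntegers F) ^ 2 * (u - w ^ 2)
  have he : e ∈ maximalIdeal (v.adicCompletionIntegers F) := Ideal.mul_mem_left _ _ huw
  have hwi : (w : v.adicCompletionIntegers F) * (↑w⁻¹ : v.adicCompletionIntegers F) = 1 :=
    w.mul_inv
  obtain ⟨z, hz⟩ := Valued.exists_sq_eq_one_add h2'
    ((mem_maximalIdeal_adicCompletionIntegers_iff v).1 he)
  have hz1 : z ∈ v.adicCompletionIntegers F := by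
    rw [mem_adicCompletionIntegers]
    have h1 : Valued.v (z ^ 2) ≤ 1 := by
      rw [hz]
      exact (1 + e).2
    rw [map_pow] at h1
    exact (pow_le_one_iff two_ne_zero).1 h1
  refine ⟨w * ⟨z, hz1⟩, ?_⟩
  have hz' : (⟨z, hz1⟩ : v.adicCompletionIntegers F) ^ 2 = 1 + e := Subtype.ext hz
  rw [mul_pow, hz']
  simp only [e]
  linear_combination (u - w ^ 2) * ((w : v.adicCompletionIntegers F) * ↑w⁻¹ + 1) * hwi

variable {v} in
/-- If ternary diagonal forms over the residue field are isotropic, then binary unimodular diagonal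
forms over the completion represent all units. -/
theorem exists_mul_sq_add_mul_sq_eq (h2 : (2 : R) ∉ v.asIdeal)
    (h : ∀ c : Option (Fin 2) → R ⧸ v.asIdeal, ∃ y : Option (Fin 2) → R ⧸ v.asIdeal,
      y ≠ 0 ∧ ∑ i, c i * y i ^ 2 = 0)
    {a b : R} (ha : a ∉ v.asIdeal) (hb : b ∉ v.asIdeal) {c : v.adicCompletionIntegers F}
    (hc : IsUnit c) :
    ∃ y z : v.adicCompletionIntegers F,
      algebraMap R _ a * y ^ 2 + algebraMap R _ b * z ^ 2 = c := by
  have := v.isMaximal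
  let := Ideal.Quotient.field v.asIdeal
  obtain ⟨r, hr⟩ := exists_sub_algebraMap_mem_maximalIdeal v c
  have hrv : r ∉ v.asIdeal := by
    rw [← algebraMap_mem_maximalIdeal_iff F v]
    intro h'
    have := add_mem hr h'
    rw [sub_add_cancel] at this
    exact this hc
  have hmk {s : R} (hs : s ∉ v.asIdeal) : Ideal.Quotient.mk v.asIdeal s ≠ 0 :=
    fun h0 => hs (Ideal.Quotient.eq_zero_iff_mem.1 h0)
  obtain ⟨y, hy⟩ := exists_sum_mul_sq_eq (K := R ⧸ v.asIdeal)
    (by rw [← map_ofNat (Ideal.Quotient.mk v.asIdeal) 2]; exact hmk h2) h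
    ![Ideal.Quotient.mk _ a, Ideal.Quotient.mk _ b]
    (by intro i; fin_cases i <;> simpa using hmk ‹_›) (Ideal.Quotient.mk _ r)
  obtain ⟨p, hp⟩ := Ideal.Quotient.mk_surjective (y 0)
  obtain ⟨q, hq⟩ := Ideal.Quotient.mk_surjective (y 1)
  have hpq : a * p ^ 2 + b * q ^ 2 - r ∈ v.asIdeal := by
    rw [← Ideal.Quotient.eq_zero_iff_mem]
    rw [Fin.sum_univ_two] at hy
    simp only [Matrix.cons_val_zero, Matrix.cons_val_one, ← hp, ← hq] at hy
    rw [map_sub, ← hy]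
    simp
  -- With one coordinate a unit modulo `v`, the other is frozen at its global lift and the unit one
  -- is corrected by Hensel's lemma. Since `r` is a unit modulo `v`, `p` and `q` are not both in
  -- `v`, so `key` applies after a possible swap.
  have key : ∀ {a b p q : R}, a ∉ v.asIdeal → p ∉ v.asIdeal →
      a * p ^ 2 + b * q ^ 2 - r ∈ v.asIdeal → ∃ y : v.adicCompletionIntegers F,
        algebraMap R _ a * y ^ 2 + algebraMap R _ b * algebraMap R _ q ^ 2 = c := by
    intro a b p q ha hp hpq
    obtain ⟨a', ha'⟩ := (isUnit_algebraMap_iff F v).2 ha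
    have hai : (a' : v.adicCompletionIntegers F) * (↑a'⁻¹ : v.adicCompletionIntegers F) = 1 :=
      a'.mul_inv
    obtain ⟨y, hy⟩ := exists_sq_eq_of_sub_mem_maximalIdeal (F := F) h2
      (u := (↑a'⁻¹ : v.adicCompletionIntegers F) * (c - algebraMap R _ b * algebraMap R _ q ^ 2))
      ((isUnit_algebraMap_iff F v).2 hp) (by
        have h1 := (algebraMap_mem_maximalIdeal_iff F v).2 hpq
        have := Ideal.mul_mem_left _ (↑a'⁻¹ : v.adicCompletionIntegers F) (sub_mem hr h1)
        convert this using 1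
        simp only [map_sub, map_add, map_mul, map_pow, ← ha']
        linear_combination (algebraMap R _ p) ^ 2 * hai)
    refine ⟨y, ?_⟩
    rw [hy, ← ha']
    linear_combination (c - algebraMap R _ b * algebraMap R _ q ^ 2) * hai
  by_cases hp0 : p ∈ v.asIdeal
  · have hq0 : q ∉ v.asIdeal := fun hq0 => hrv <| by
      have := sub_mem (add_mem (Ideal.mul_mem_left _ (a * p) hp0)
        (Ideal.mul_mem_left _ (b * q) hq0)) hpq
      convert this using 1
      ring
    obtain ⟨z, hz⟩ := key (p := q) (q := p) (b := a) hb hq0 (by rwa [add_comm (b * _)])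
    exact ⟨_, z, (add_comm _ _).trans hz⟩
  · obtain ⟨y, hy⟩ := key ha hp0 hpq
    exact ⟨y, _, hy⟩

end IsDedekindDomain.HeightOneSpectrum

/-! ### Parity of degrees over `k[x]`. -/

section Degree

variable {k : Type*} [Field k] {t : k}

open Polynomial

/-- The leading terms of `P` and `t Q` do not cancel if `P` and `Q` have square leading
coefficients and `t` is not a square. -/
theorem Polynomial.natDegree_sub_C_mul (ht : ¬ IsSquare t) {P Q : k[X]}
    (hP : IsSquare P.leadingCoeff) (hQ : IsSquare Q.leadingCoeff) :
    (P - C t * Q).natDegree = max P.natDegree Q.natDegree := by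
  have ht0 : t ≠ 0 := by rintro rfl; exact ht (IsSquare.zero)
  have hQt : (C t * Q).natDegree = Q.natDegree := natDegree_C_mul ht0
  rcases lt_trichotomy P.natDegree Q.natDegree with h | h | h
  · rw [natDegree_sub_eq_right_of_natDegree_lt (by rwa [hQt]), hQt, max_eq_right h.le]
  · refine le_antisymm (by simpa [hQt] using natDegree_sub_le P (C t * Q)) ?_
    rw [h, max_self]
    by_cases h0 : (P - C t * Q).coeff Q.natDegree = 0
    · obtain ⟨α, hα⟩ := hP
      obtain ⟨β, hβ⟩ := hQ
      rw [leadingCoeff, h] at hα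
      rw [leadingCoeff] at hβ
      rw [coeff_sub, coeff_C_mul, hα, hβ, ← sq, ← sq] at h0
      rw [(eq_zero_of_sq_sub_mul_sq ht h0).2, mul_zero, coeff_natDegree,
        leadingCoeff_eq_zero] at hβ
      simp [hβ]
    · exact le_natDegree_of_ne_zero h0
  · rw [natDegree_sub_eq_left_of_natDegree_lt (by rwa [hQt]), max_eq_left h.le]

theorem Polynomial.Monic.isSquare_leadingCoeff_mul_sq {g : k[X]} (hg : g.Monic) (a : k[X]) :
    IsSquare (g * a ^ 2).leadingCoeff :=
  ⟨a.leadingCoeff, by rw [leadingCoeff_mul, hg, one_mul, leadingCoeff_pow, sq]⟩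

theorem Polynomial.isSquare_leadingCoeff_sq (a : k[X]) : IsSquare (a ^ 2).leadingCoeff := by
  simpa using monic_one.isSquare_leadingCoeff_mul_sq a

theorem Polynomial.Monic.even_natDegree_mul_sq {g : k[X]} (hg : g.Monic) (he : Even g.natDegree)
    (a : k[X]) : Even (g * a ^ 2).natDegree := by
  rcases eq_or_ne a 0 with rfl | ha
  · simp
  · rw [hg.natDegree_mul' (pow_ne_zero 2 ha), Polynomial.natDegree_pow]
    exact he.add (even_two_mul _)

theorem even_max {m n : ℕ} (hm : Even m) (hn : Even n) : Even (max m n) := by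
  rcases max_choice m n with h | h <;> rwa [h]

/-- Without cancellation the degree is the larger of two even numbers; the convention `natDegree 0 =
0` keeps the zero polynomial consistent with this. -/
theorem Polynomial.even_natDegree_sq_sub_C_mul_sq (ht : ¬ IsSquare t) (a b : k[X]) :
    Even (a ^ 2 - C t * b ^ 2).natDegree := by
  rw [natDegree_sub_C_mul ht (isSquare_leadingCoeff_sq a) (isSquare_leadingCoeff_sq b)]
  exact even_max (by simp) (by simp)

/-- `⟨1, -t, xt, -xg⟩` does not represent `x` over `k[x]`. -/
theorem Polynomial.not_represents_X (ht : ¬ IsSquare t) {g : k[X]} (hg : g.Monic)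
    (hgeven : Even g.natDegree) (hgdeg : 1 < g.natDegree) {a b c d : k[X]} :
    a ^ 2 - C t * b ^ 2 + X * (C t * c ^ 2 - g * d ^ 2) ≠ X := by
  intro h
  have hU := even_natDegree_sq_sub_C_mul_sq ht a b
  have hUn := natDegree_sub_C_mul ht (isSquare_leadingCoeff_sq a) (isSquare_leadingCoeff_sq b)
  have hWn := natDegree_sub_C_mul ht (hg.isSquare_leadingCoeff_mul_sq d)
    (isSquare_leadingCoeff_sq c)
  have hW : Even (g * d ^ 2 - C t * c ^ 2).natDegree := by
    rw [hWn]
    exact even_max (hg.even_natDegree_mul_sq hgeven d) (by simp)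
  set U := a ^ 2 - C t * b ^ 2
  set W := g * d ^ 2 - C t * c ^ 2
  have hUW : U = X * (1 + W) := by
    simp only [W]
    linear_combination h
  -- Otherwise `X * (1 + W)` has odd degree, whereas `U` has even degree.
  have hW0 : W.natDegree = 0 := by
    by_contra hW0
    have h1W : (1 + W).natDegree = W.natDegree := by
      rw [natDegree_add_eq_right_of_natDegree_lt (by rw [natDegree_one]; omega)]
    have hne : 1 + W ≠ 0 := by
      intro h0
      rw [h0, natDegree_zero] at h1W
      exact hW0 h1W.symm
    rw [hUW, natDegree_X_mul hne, h1W] at hU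
    exact (Nat.not_even_iff_odd.2 hW.add_one) hU
  have hd : d = 0 := by
    by_contra hd
    have : (g * d ^ 2).natDegree ≤ 0 := by rw [← hW0, hWn]; exact le_max_left _ _
    rw [hg.natDegree_mul' (pow_ne_zero 2 hd)] at this
    omega
  have hU0 : U.natDegree = 0 := by
    have : U.natDegree ≤ 1 := by
      rw [hUW]
      refine natDegree_mul_le.trans ?_
      have := natDegree_add_le (1 : k[X]) W
      simp only [natDegree_one, hW0, max_self] at this
      simp only [natDegree_X]
      omega
    obtain ⟨r, hr⟩ := hU
    omega
  -- Now `U = X (1 + W)` is constant, so the factor `1 + W` vanishes. With `d = 0` this reads `t c²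
  -- = 1`, contradicting that `t` is not a square.
  have h1W : 1 + W = 0 := by
    by_contra hne
    rw [hUW, natDegree_X_mul hne] at hU0
    omega
  have hc : c.natDegree = 0 := by
    have : (c ^ 2).natDegree ≤ 0 := by rw [← hW0, hWn]; exact le_max_right _ _
    rw [natDegree_pow] at this
    omega
  obtain ⟨c, rfl⟩ : ∃ c₀, c = C c₀ := ⟨_, eq_C_of_natDegree_eq_zero hc⟩
  have htc : t * c ^ 2 = 1 := by
    simp only [W, hd] at h1W
    have := congrArg (eval 0) h1W
    simp only [eval_add, eval_sub, eval_mul, eval_pow, eval_C, eval_one, eval_zero] at this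
    linear_combination -this
  refine ht ⟨c⁻¹, ?_⟩
  have hc0 : c ≠ 0 := by rintro rfl; simp at htc
  field_simp
  exact htc

/-- The vectors of length `1` in `⟨1, -t, xt, -xg⟩`, with denominators at most `x` and `xg` in the
last two coordinates, lie in the constant plane `⟨1, -t⟩`. -/
theorem Polynomial.eq_zero_of_form_eq_one (ht : ¬ IsSquare t) {g : k[X]} (hg : g.Monic)
    (hgeven : Even g.natDegree) (hgdeg : 1 < g.natDegree) {a b c d : k[X]}
    (h : X * g * (a ^ 2 - C t * b ^ 2) + C t * (g * c ^ 2) - d ^ 2 = X * g) : c = 0 := by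
  have hU := even_natDegree_sq_sub_C_mul_sq ht a b
  have hWn := natDegree_sub_C_mul ht (isSquare_leadingCoeff_sq d)
    (hg.isSquare_leadingCoeff_mul_sq c)
  have hW : Even (d ^ 2 - C t * (g * c ^ 2)).natDegree := by
    rw [hWn]
    exact even_max (by simp) (hg.even_natDegree_mul_sq hgeven c)
  set U := a ^ 2 - C t * b ^ 2
  set W := d ^ 2 - C t * (g * c ^ 2)
  have hUW : W = X * (g * (U - 1)) := by
    simp only [W]
    linear_combination -h
  -- If nonzero, `X g (U - 1)` has odd degree, as `g` and `U` have even degree; but it equals `W`,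
  -- of even degree. So `W = 0`, and `g c²`, whose degree is at most that of `W`, leaves no room for
  -- `c ≠ 0`.
  have hU1 : U - 1 = 0 := by
    by_contra hne
    have hdeg : (U - 1).natDegree = U.natDegree := by
      rw [← C_1, natDegree_sub_C]
    rw [hUW, natDegree_X_mul (mul_ne_zero hg.ne_zero hne), hg.natDegree_mul' hne, hdeg] at hW
    exact (Nat.not_even_iff_odd.2 (hgeven.add hU).add_one) hW
  by_contra hc
  have : (g * c ^ 2).natDegree ≤ W.natDegree := by rw [hWn]; exact le_max_right _ _
  rw [hUW, hU1, mul_zero, mul_zero, natDegree_zero, hg.natDegree_mul' (pow_ne_zero 2 hc)] at this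
  omega

end Degree

/-! ### Residue fields of `k[x]` and factorization by a uniformizer. -/

namespace IsDedekindDomain.HeightOneSpectrum

variable {k : Type*} [Field k]

theorem finite_polynomial_quotient (v : HeightOneSpectrum k[X]) :
    Module.Finite k (k[X] ⧸ v.asIdeal) := by
  obtain ⟨f, hf⟩ := IsPrincipalIdealRing.principal v.asIdeal
  have hf0 : f ≠ 0 := by
    rintro rfl
    exact v.ne_bot (by simpa using hf)
  have hspan : v.asIdeal = Ideal.span {f * Polynomial.C f.leadingCoeff⁻¹} := by
    rw [hf, Ideal.submodule_span_eq, Ideal.span_singleton_mul_right_unit]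
    exact Polynomial.isUnit_C.2 (by simpa using hf0)
  rw [hspan]
  exact (Polynomial.monic_mul_leadingCoeff_inv hf0).finite_quotient

theorem C_notMem_asIdeal (v : HeightOneSpectrum k[X]) {a : k} (ha : a ≠ 0) :
    Polynomial.C a ∉ v.asIdeal := fun h =>
  v.isPrime.ne_top (Ideal.eq_top_of_isUnit_mem _ h (Polynomial.isUnit_C.2 ha.isUnit))

theorem _root_.IsC1Field.quotient_isotropic (hk : IsC1Field k) {t : k} (ht : ¬ IsSquare t)
    (v : HeightOneSpectrum k[X]) (c : Option (Fin 2) → k[X] ⧸ v.asIdeal) :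
    ∃ y : Option (Fin 2) → k[X] ⧸ v.asIdeal, y ≠ 0 ∧ ∑ i, c i * y i ^ 2 = 0 := by
  have := v.isMaximal
  let := Ideal.Quotient.field v.asIdeal
  have := finite_polynomial_quotient v
  exact hk.finite_isotropic ht (by simp) c

variable {R : Type*} [CommRing R] [IsDedekindDomain R] {F : Type*} [Field F] [Algebra R F]
  [IsFractionRing R F] {v : HeightOneSpectrum R}

open WithZero in
/-- Factorization of integral elements of the completion with respect to a global uniformizer. -/
theorem exists_eq_pow_mul_unit {π : R} (hπ : v.intValuation π = exp (-1 : ℤ))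
    {c : v.adicCompletionIntegers F} (hc : c ≠ 0) :
    ∃ (n : ℕ) (u : v.adicCompletionIntegers F), IsUnit u ∧ c = algebraMap R _ π ^ n * u := by
  have hπv : Valued.v (algebraMap R (v.adicCompletion F) π) = exp (-1 : ℤ) := by
    rw [valued_algebraMap_adicCompletion, valuation_of_algebraMap, hπ]
  have hc0 : Valued.v (c : v.adicCompletion F) ≠ 0 := by simpa using hc
  have hc1 : Valued.v (c : v.adicCompletion F) ≤ 1 := c.2
  obtain ⟨n, hn⟩ : ∃ n : ℕ, Valued.v (c : v.adicCompletion F) = exp (-1 : ℤ) ^ n := by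
    refine ⟨(-log (Valued.v (c : v.adicCompletion F))).toNat, ?_⟩
    have h0 : log (Valued.v (c : v.adicCompletion F)) ≤ 0 := by
      rw [← log_one]
      exact (log_le_log hc0 one_ne_zero).2 hc1
    rw [← exp_nsmul]
    conv_lhs => rw [← exp_log hc0]
    congr 1
    simp
    omega
  have hπ0 : algebraMap R (v.adicCompletion F) π ^ n ≠ 0 := by
    rw [← Valuation.ne_zero_iff Valued.v, map_pow, hπv]
    simp
  have hu : Valued.v ((c : v.adicCompletion F) / algebraMap R (v.adicCompletion F) π ^ n) = 1 := by
    rw [map_div₀, hn, map_pow, hπv, div_self (by simp)]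
  refine ⟨n, ⟨_, hu.le⟩, adicCompletionIntegers.isUnit_iff_valued_eq_one.2 hu, Subtype.ext ?_⟩
  change (c : v.adicCompletion F) = algebraMap R (v.adicCompletion F) π ^ n * (_ / _)
  rw [mul_div_cancel₀ _ hπ0]

end IsDedekindDomain.HeightOneSpectrum

/-! ### Universality, local universality and the Hasse principle for the lattice. -/

namespace DiagLattice

theorem form_apply {R : Type*} [CommRing R] {ι : Type*} [Fintype ι] (a : ι → R) (A : Type*)
    [CommRing A] [Algebra R A] (y : ι → A) :
    form a A y = ∑ i, algebraMap R A (a i) * y i ^ 2 := by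
  simp [form, QuadraticMap.weightedSumSquares_apply, sq]

theorem representsOver_iff {R : Type*} [CommRing R] {ι : Type*} [Fintype ι] (a : ι → R) (c : R)
    (A : Type*) [CommRing A] [Algebra R A] :
    RepresentsOver a c A ↔ ∃ y, form a A y = algebraMap R A c := by
  constructor
  · rintro ⟨σ⟩
    refine ⟨σ 1, ?_⟩
    rw [σ.map_app, form_apply]
    simp
  · rintro ⟨y, hy⟩
    refine ⟨⟨LinearMap.toSpanSingleton A (ι → A) y ∘ₗ LinearMap.proj (), fun z => ?_⟩⟩
    simp only [LinearMap.toFun_eq_coe, LinearMap.comp_apply, LinearMap.proj_apply,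
      LinearMap.toSpanSingleton_apply]
    rw [QuadraticMap.map_smul, hy, form_apply]
    simp [sq, mul_comm]

variable {k : Type*} [Field k] {t : k} {g : k[X]}

open Polynomial in
/-- The diagonal entries of the lattice `⟨1, -t, xt, -xg⟩`. -/
abbrev entries (t : k) (g : k[X]) : Fin 4 → k[X] := ![1, -C t, X * C t, -(X * g)]

theorem form_entries (A : Type*) [CommRing A] [Algebra k[X] A] (y : Fin 4 → A) :
    form (entries t g) A y = y 0 ^ 2 - algebraMap k[X] A (.C t) * y 1 ^ 2 +
      algebraMap k[X] A .X * (algebraMap k[X] A (.C t) * y 2 ^ 2 -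
        algebraMap k[X] A g * y 3 ^ 2) := by
  rw [form_apply, Fin.sum_univ_four]
  simp
  ring

theorem entries_ne_zero (ht : t ≠ 0) (hg : g ≠ 0) (i : Fin 4) : entries t g i ≠ 0 := by
  fin_cases i <;> simp [ht, hg]

theorem isUniversalOver_fractionField (h2 : (2 : k) ≠ 0) (hk : IsC1Field k) (ht : ¬ IsSquare t)
    (hg : g ≠ 0) (F : Type*) [Field F] [Algebra k[X] F] [IsFractionRing k[X] F] :
    IsUniversalOver (entries t g) F := by
  have ht0 : t ≠ 0 := by rintro rfl; exact ht IsSquare.zero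
  have hinj := IsFractionRing.injective k[X] F
  intro c _
  obtain ⟨y, hy⟩ := exists_sum_mul_sq_eq (K := F) (ι := Fin 4)
    (by
      rw [← map_ofNat (algebraMap k[X] F) 2, ← Polynomial.C_ofNat]
      simpa using h2)
    (hk.fractionRing_isotropic ht (by simp)) (fun i => algebraMap k[X] F (entries t g i))
    (fun i => by
      rw [Ne, map_eq_zero_iff _ hinj]
      exact entries_ne_zero ht0 hg i) c
  exact ⟨y, by rw [form_apply, hy]⟩

open HeightOneSpectrum in
theorem isLocallyUniversalAt (h2 : (2 : k) ≠ 0) (hk : IsC1Field k) (ht : ¬ IsSquare t)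
    (hg0 : g.eval 0 = 1) (F : Type*) [Field F] [Algebra k[X] F] [IsFractionRing k[X] F]
    (v : HeightOneSpectrum k[X]) : IsLocallyUniversalAt F (entries t g) v := by
  have ht0 : t ≠ 0 := by rintro rfl; exact ht IsSquare.zero
  have h2v : (2 : k[X]) ∉ v.asIdeal := C_notMem_asIdeal v h2
  have h1v : (1 : k[X]) ∉ v.asIdeal := C_notMem_asIdeal v one_ne_zero
  have htv : -Polynomial.C t ∉ v.asIdeal := by
    rw [neg_mem_iff]
    exact C_notMem_asIdeal v ht0
  have key {c : v.adicCompletionIntegers F} (hc : IsUnit c) :=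
    exists_mul_sq_add_mul_sq_eq F h2v (hk.quotient_isotropic ht v) h1v htv hc
  intro c hc0
  by_cases hX : Polynomial.X ∈ v.asIdeal
  · have hspan : v.asIdeal = Ideal.span {Polynomial.X} := by
      refine ((PrincipalIdealRing.isMaximal_of_irreducible Polynomial.irreducible_X).eq_of_le
        v.isPrime.ne_top ?_).symm
      rwa [Ideal.span_singleton_le_iff_mem]
    have hgv : -g ∉ v.asIdeal := by
      rw [neg_mem_iff, hspan, Ideal.mem_span_singleton, Polynomial.X_dvd_iff,
        Polynomial.coeff_zero_eq_eval_zero, hg0]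
      exact one_ne_zero
    obtain ⟨n, u, hu, rfl⟩ := exists_eq_pow_mul_unit
      (intValuation_singleton v Polynomial.X_ne_zero hspan) hc0
    obtain ⟨m, rfl | rfl⟩ := n.even_or_odd'
    · obtain ⟨y, z, h⟩ := key hu
      refine ⟨![algebraMap k[X] _ Polynomial.X ^ m * y,
        algebraMap k[X] _ Polynomial.X ^ m * z, 0, 0], ?_⟩
      rw [form_entries, ← h]
      simp
      ring
    · obtain ⟨y, z, h⟩ := exists_mul_sq_add_mul_sq_eq F h2v (hk.quotient_isotropic ht v)
        (C_notMem_asIdeal v ht0) hgv hu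
      refine ⟨![0, 0, algebraMap k[X] _ Polynomial.X ^ m * y,
        algebraMap k[X] _ Polynomial.X ^ m * z], ?_⟩
      rw [form_entries, ← h]
      simp
      ring
  · by_cases hc : IsUnit c
    · obtain ⟨y, z, h⟩ := key hc
      refine ⟨![y, z, 0, 0], ?_⟩
      rw [form_entries, ← h]
      simp
      ring
    -- For a non-unit `c`, subtracting the unit `xt` (the vector `v₃`) leaves a unit, which `⟨1,-t⟩`
    -- represents.
    · have hXt : IsUnit (algebraMap k[X] (v.adicCompletionIntegers F) (.X * .C t)) := by
        rw [isUnit_algebraMap_iff]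
        exact fun h => (v.isPrime.mem_or_mem h).elim hX (C_notMem_asIdeal v ht0)
      have hc' : IsUnit (c - algebraMap k[X] (v.adicCompletionIntegers F) (.X * .C t)) := by
        by_contra h'
        have := (IsLocalRing.maximalIdeal (v.adicCompletionIntegers F)).sub_mem
          (show c ∈ _ from hc) h'
        rw [sub_sub_cancel] at this
        exact this hXt
      obtain ⟨y, z, h⟩ := key hc'
      refine ⟨![y, z, 1, 0], ?_⟩
      rw [form_entries, ← sub_add_cancel c, ← h]
      simp
      ring

theorem not_representsOver_X (ht : ¬ IsSquare t) (hg : g.Monic) (hgeven : Even g.natDegree)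
    (hgdeg : 1 < g.natDegree) : ¬ RepresentsOver (entries t g) Polynomial.X k[X] := by
  rw [representsOver_iff]
  rintro ⟨y, hy⟩
  rw [form_entries] at hy
  exact Polynomial.not_represents_X ht hg hgeven hgdeg hy

theorem not_hassePrinciple (h2 : (2 : k) ≠ 0) (hk : IsC1Field k) (ht : ¬ IsSquare t)
    (hg : g.Monic) (hgeven : Even g.natDegree) (hgdeg : 1 < g.natDegree) (hg0 : g.eval 0 = 1)
    (F : Type*) [Field F] [Algebra k[X] F] [IsFractionRing k[X] F] :
    ¬ HassePrinciple F (fun _ : Unit => (Polynomial.X : k[X])) (entries t g) := by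
  intro h
  refine not_representsOver_X ht hg hgeven hgdeg (h ⟨?_, fun v => ?_⟩)
  · refine (representsOver_iff _ _ _).2 (isUniversalOver_fractionField h2 hk ht hg.ne_zero F _ ?_)
    rw [Ne, map_eq_zero_iff _ (IsFractionRing.injective k[X] F)]
    exact Polynomial.X_ne_zero
  · refine (representsOver_iff _ _ _).2 (isLocallyUniversalAt h2 hk ht hg0 F v _ ?_)
    rw [Ne, map_eq_zero_iff _ (FaithfulSMul.algebraMap_injective _ _)]
    exact Polynomial.X_ne_zero

/-! ### Finite generation and integrality in Clifford algebras of diagonal forms. -/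

section Clifford

variable {R : Type*} [CommRing R] {ι : Type*} [Fintype ι] (a : ι → R)
  (A : Type*) [CommRing A] [Algebra R A]

theorem polar_form (y z : ι → A) :
    QuadraticMap.polar (form a A) y z = 2 * ∑ i, algebraMap R A (a i) * y i * z i := by
  simp only [QuadraticMap.polar, form_apply, ← Finset.sum_sub_distrib, Finset.mul_sum]
  refine Finset.sum_congr rfl fun i _ => ?_
  rw [Pi.add_apply]
  ring

variable [DecidableEq ι]

/-- The generators of the Clifford algebra of a diagonal form. -/
def gen (i : ι) : CliffordAlgebra (form a A) := CliffordAlgebra.ι (form a A) (Pi.single i 1)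

theorem form_single (i : ι) : form a A (Pi.single i 1) = algebraMap R A (a i) := by
  rw [form_apply, Finset.sum_eq_single i] <;> simp +contextual

theorem polar_form_single (y : ι → A) (i : ι) :
    QuadraticMap.polar (form a A) y (Pi.single i 1) = 2 * (algebraMap R A (a i) * y i) := by
  rw [polar_form, Finset.sum_eq_single i] <;> simp +contextual

theorem gen_mul_self (i : ι) : gen a A i * gen a A i = algebraMap A _ (algebraMap R A (a i)) := by
  rw [gen, CliffordAlgebra.ι_sq_scalar, form_single]

theorem gen_mul_gen_of_ne {i j : ι} (hij : i ≠ j) :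
    gen a A i * gen a A j = -(gen a A j * gen a A i) := by
  refine CliffordAlgebra.ι_mul_ι_comm_of_isOrtho ?_
  rw [QuadraticMap.isOrtho_def, ← sub_eq_zero, ← sub_sub]
  exact (polar_form_single a A (Pi.single i 1) j).trans (by simp [hij])

theorem ι_eq_sum_gen (y : ι → A) :
    CliffordAlgebra.ι (form a A) y = ∑ i, y i • gen a A i := by
  conv_lhs => rw [pi_eq_sum_univ' y]
  simp [gen, map_sum]

/-- The span of the ordered products of distinct generators from a list. -/
def genProd (l : List ι) : Submodule A (CliffordAlgebra (form a A)) :=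
  (l.map fun i => 1 ⊔ Submodule.span A {gen a A i}).prod

theorem one_le_genProd (l : List ι) : 1 ≤ genProd a A l := by
  induction l with
  | nil => exact le_of_eq rfl
  | cons j l ih =>
    rw [genProd, List.map_cons, List.prod_cons]
    calc (1 : Submodule A (CliffordAlgebra (form a A))) = 1 * 1 := (mul_one 1).symm
      _ ≤ _ := mul_le_mul' le_sup_left ih

/-- Generators anticommute, so the new one can be moved past the others until it meets its own
factor, where its square is a scalar. -/
theorem span_gen_mul_genProd_le {l : List ι} {i : ι} (hi : i ∈ l) :
    Submodule.span A {gen a A i} * genProd a A l ≤ genProd a A l := by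
  induction l with
  | nil => simp at hi
  | cons j l ih =>
    rw [genProd, List.map_cons, List.prod_cons, ← genProd, ← mul_assoc]
    by_cases hij : i = j
    · subst hij
      refine mul_le_mul_left ?_ _
      rw [Submodule.mul_sup, mul_one, Submodule.span_mul_span, Set.singleton_mul_singleton,
        gen_mul_self]
      refine sup_le le_sup_right (le_sup_of_le_left ?_)
      rw [Submodule.span_singleton_le_iff_mem]
      exact Submodule.algebraMap_mem _
    · have hcomm : Submodule.span A {gen a A i} * (1 ⊔ Submodule.span A {gen a A j}) =
          (1 ⊔ Submodule.span A {gen a A j}) * Submodule.span A {gen a A i} := by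
        rw [Submodule.mul_sup, Submodule.sup_mul, mul_one, one_mul, Submodule.span_mul_span,
          Submodule.span_mul_span, Set.singleton_mul_singleton, Set.singleton_mul_singleton,
          gen_mul_gen_of_ne a A hij, ← Set.neg_singleton, Submodule.span_neg]
      rw [hcomm, mul_assoc]
      exact mul_le_mul_right (ih (by simpa [hij] using hi)) _

theorem genProd_fg (l : List ι) : (genProd a A l).FG := by
  have h1 : (1 : Submodule A (CliffordAlgebra (form a A))).FG := by
    rw [Submodule.one_eq_span]
    exact Submodule.fg_span_singleton 1
  induction l with
  | nil => exact h1
  | cons j l ih =>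
    rw [genProd, List.map_cons, List.prod_cons]
    exact (h1.sup (Submodule.fg_span_singleton _)).mul ih

end Clifford

theorem finite_cliffordAlgebra {R : Type*} [CommRing R] {ι : Type*} [Fintype ι] (a : ι → R)
    (A : Type*) [CommRing A] [Algebra R A] : Module.Finite A (CliffordAlgebra (form a A)) := by
  classical
  refine ⟨?_⟩
  convert genProd_fg a A Finset.univ.toList
  refine (eq_top_iff.2 fun z _ => ?_).symm
  induction z using CliffordAlgebra.left_induction with
  | algebraMap r =>
    exact one_le_genProd a A _ (Submodule.algebraMap_mem r)
  | add x y hx hy => exact add_mem (hx trivial) (hy trivial)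
  | ι_mul x y hx =>
    rw [ι_eq_sum_gen, Finset.sum_mul]
    refine sum_mem fun i _ => ?_
    rw [smul_mul_assoc]
    exact Submodule.smul_mem _ _ (span_gen_mul_genProd_le a A (by simp)
      (Submodule.mul_mem_mul (Submodule.mem_span_singleton_self _) (hx trivial)))

/-- Multiplying by the conjugate collapses the product to the four values of `Q`; the four signs
from `star` cancel. -/
theorem ι_mul_ι_mul_ι_mem_spinGroup {R : Type*} [CommRing R] {M : Type*} [AddCommGroup M] [Module R M]
    {Q : QuadraticForm R M} {w x y z : M} (hw : IsUnit (Q w)) (hx : IsUnit (Q x))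
    (hy : IsUnit (Q y)) (hz : IsUnit (Q z)) (h : Q w * Q x * Q y * Q z = 1) :
    CliffordAlgebra.ι Q w * CliffordAlgebra.ι Q x * (CliffordAlgebra.ι Q y * CliffordAlgebra.ι Q z)
      ∈ spinGroup Q := by
  have key {m : M} (hm : IsUnit (Q m)) :
      ∃ u ∈ lipschitzGroup Q, (u : CliffordAlgebra Q) = CliffordAlgebra.ι Q m := by
    obtain ⟨u, hu⟩ := CliffordAlgebra.isUnit_ι_of_isUnit Q hm
    exact ⟨u, Subgroup.subset_closure ⟨m, hu.symm⟩, hu⟩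
  obtain ⟨w', hw', hw⟩ := key hw
  obtain ⟨x', hx', hx⟩ := key hx
  obtain ⟨y', hy', hy⟩ := key hy
  obtain ⟨z', hz', hz⟩ := key hz
  have hmul (m : M) (c : CliffordAlgebra Q) :
      CliffordAlgebra.ι Q m * (CliffordAlgebra.ι Q m * c) = Q m • c := by
    rw [← mul_assoc, CliffordAlgebra.ι_sq_scalar, Algebra.smul_def]
  refine ⟨⟨⟨w' * x' * (y' * z'), mul_mem (mul_mem hw' hx') (mul_mem hy' hz'), by
    simp [hw, hx, hy, hz]⟩, ?_⟩, ?_⟩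
  · rw [SetLike.mem_coe, Unitary.mem_iff]
    simp only [star_mul, CliffordAlgebra.star_ι, mul_assoc, neg_mul, mul_neg, neg_neg,
      CliffordAlgebra.ι_sq_scalar, hmul, mul_smul_comm]
    simp only [Algebra.algebraMap_eq_smul_one, smul_smul]
    constructor <;> refine (congrArg (· • (1 : CliffordAlgebra Q)) ?_).trans (one_smul R _) <;>
      linear_combination h
  · exact mul_mem (CliffordAlgebra.ι_mul_ι_mem_evenOdd_zero _ _ _)
      (CliffordAlgebra.ι_mul_ι_mem_evenOdd_zero _ _ _)

section Clifford

variable {R : Type*} [CommRing R] {ι : Type*} [Fintype ι] (a : ι → R)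
  (A B : Type*) [CommRing A] [Algebra R A] [CommRing B] [Algebra R B]
  [Algebra A B] [IsScalarTower R A B]

theorem cliffordMap_gen [DecidableEq ι] (i : ι) : cliffordMap A B a (gen a A i) = gen a B i := by
  rw [gen, cliffordMap_ι, gen]
  congr 1
  funext j
  rcases eq_or_ne j i with rfl | h <;> simp [vecMap, *]

theorem cliffordMap_algebraMap (r : A) :
    cliffordMap A B a (algebraMap A _ r) = algebraMap B _ (algebraMap A B r) := by
  rw [AlgHom.commutes, IsScalarTower.algebraMap_apply A B (CliffordAlgebra (form a B))]

theorem cliffordMap_smul (r : A) (z : CliffordAlgebra (form a A)) :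
    cliffordMap A B a (r • z) = algebraMap A B r • cliffordMap A B a z := by
  rw [map_smul, algebraMap_smul]

theorem span_range_cliffordMap :
    Submodule.span B (Set.range (cliffordMap A B a)) = ⊤ := by
  classical
  refine eq_top_iff.2 fun z _ => ?_
  induction z using CliffordAlgebra.left_induction with
  | algebraMap r =>
    rw [Algebra.algebraMap_eq_smul_one, ← map_one (cliffordMap A B a)]
    exact Submodule.smul_mem _ _ (Submodule.subset_span ⟨1, rfl⟩)
  | add x y hx hy => exact add_mem (hx trivial) (hy trivial)
  | ι_mul x y hx =>
    rw [ι_eq_sum_gen, Finset.sum_mul]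
    refine sum_mem fun i _ => ?_
    rw [smul_mul_assoc, ← cliffordMap_gen a A B]
    refine Submodule.smul_mem _ _ ?_
    have hi : cliffordMap A B a (gen a A i) ∈
        Submodule.span B (Set.range (cliffordMap A B a)) := Submodule.subset_span ⟨_, rfl⟩
    have h := Submodule.mul_mem_mul hi (hx trivial)
    rw [Submodule.span_mul_span] at h
    refine Submodule.span_mono ?_ h
    rintro _ ⟨_, ⟨p, rfl⟩, _, ⟨q, rfl⟩, rfl⟩
    exact ⟨p * q, map_mul _ _ _⟩

/-- The Clifford algebra over `A` is a finite module, so its elements are integral over `A`; a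
scalar among their images is then in the integrally closed ring `A`. No basis of the Clifford
algebra is needed. -/
theorem exists_algebraMap_eq_of_algebraMap_eq_cliffordMap {A K : Type*} [CommRing A] [IsDomain A]
    [Algebra R A] [IsIntegrallyClosed A] [Field K] [Algebra R K] [Algebra A K]
    [IsScalarTower R A K] [IsFractionRing A K] (h2 : (2 : K) ≠ 0) {s : K}
    {w : CliffordAlgebra (form a A)}
    (h : algebraMap K (CliffordAlgebra (form a K)) s = cliffordMap A K a w) :
    ∃ d : A, algebraMap A K d = s := by
  let := invertibleOfNonzero h2
  have := finite_cliffordAlgebra a A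
  have hw : IsIntegral A (cliffordMap A K a w) := (IsIntegral.of_finite A w).map (cliffordMap A K a)
  rw [← h, isIntegral_algebraMap_iff (algebraMap K (CliffordAlgebra (form a K))).injective] at hw
  exact IsIntegrallyClosed.isIntegral_iff.1 hw

end Clifford

/-! ### Lattices in the local Clifford algebras. -/

section Local

variable {R : Type*} [CommRing R] [IsDedekindDomain R] {ι : Type*} [Fintype ι]
  (F : Type*) [Field F] [Algebra R F] [IsFractionRing R F] (a : ι → R) (v : HeightOneSpectrum R)

open Topology in
/-- The lattices `c C(L_v)` are open in `C(V_v)`. -/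
theorem isOpen_smul_range_cliffordMap {c : v.adicCompletion F} (hc : c ≠ 0) :
    IsOpen[moduleTopology (v.adicCompletion F) (CliffordAlgebra (form a (v.adicCompletion F)))]
      {z | ∃ w, z = c • cliffordMap (v.adicCompletionIntegers F) (v.adicCompletion F) a w} := by
  let O := v.adicCompletionIntegers F
  let K := v.adicCompletion F
  let C := CliffordAlgebra (form a K)
  let := moduleTopology K C
  have := finite_cliffordAlgebra a O
  obtain ⟨n, w, hw⟩ := Module.Finite.exists_fin (R := O) (M := CliffordAlgebra (form a O))
  let φ : (Fin n → K) →ₗ[K] C := Fintype.linearCombination K fun i => cliffordMap O K a (w i)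
  have hφ : Function.Surjective φ := by
    rw [← LinearMap.range_eq_top, Fintype.range_linearCombination, eq_top_iff,
      ← span_range_cliffordMap a O K, Submodule.span_le]
    rintro _ ⟨z, rfl⟩
    have hz : z ∈ Submodule.span O (Set.range w) := hw ▸ Submodule.mem_top
    obtain ⟨x, rfl⟩ := (Submodule.mem_span_range_iff_exists_fun O).1 hz
    rw [map_sum]
    refine sum_mem fun i _ => ?_
    rw [cliffordMap_smul]
    exact Submodule.smul_mem _ _ (Submodule.subset_span ⟨i, rfl⟩)
  -- The lattice is the image of the open box `(c O)ⁿ` under `φ`, and a surjective linear map to a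
  -- space with the module topology is open.
  have hopen : IsOpen {x : Fin n → K | ∀ i, c⁻¹ * x i ∈ O} := by
    simp only [Set.ofPred_forall]
    refine isOpen_iInter_of_finite fun i => ?_
    exact (Valued.isOpen_valuationSubring K).preimage
      (continuous_const.mul (continuous_apply i))
  convert IsModuleTopology.isOpenMap_of_surjective (R := K) hφ _ hopen using 1
  ext z
  constructor
  · rintro ⟨z, rfl⟩
    have hz : z ∈ Submodule.span O (Set.range w) := hw ▸ Submodule.mem_top
    obtain ⟨x, rfl⟩ := (Submodule.mem_span_range_iff_exists_fun O).1 hz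
    refine ⟨fun i => c * x i, fun i => ?_, ?_⟩
    · rw [inv_mul_cancel_left₀ hc]
      exact (x i).2
    · simp only [φ, Fintype.linearCombination_apply, map_sum, Finset.smul_sum]
      refine Finset.sum_congr rfl fun i _ => ?_
      rw [cliffordMap_smul, smul_smul]
      rfl
  · rintro ⟨x, hx, rfl⟩
    refine ⟨∑ i, (⟨_, hx i⟩ : O) • w i, ?_⟩
    simp only [φ, Fintype.linearCombination_apply, map_sum, Finset.smul_sum]
    refine Finset.sum_congr rfl fun i _ => ?_
    rw [cliffordMap_smul, smul_smul]
    change _ = (c * (c⁻¹ * x i)) • _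
    rw [mul_inv_cancel_left₀ hc]

theorem isOpen_integralSpin : IsOpen (integralSpin F a v) := by
  have := isOpen_smul_range_cliffordMap F a v one_ne_zero
  refine ⟨_, this, ?_⟩
  ext γ
  simp only [one_smul]
  exact exists_congr fun _ => eq_comm

variable {F a v} in
/-- The scalars in the lattice `c C(L_v)` are the elements of `c R_v`. -/
theorem exists_eq_mul_of_algebraMap_eq (h2 : (2 : F) ≠ 0) {s c : v.adicCompletion F} (hc : c ≠ 0)
    {w : CliffordAlgebra (form a (v.adicCompletionIntegers F))}
    (h : algebraMap _ (CliffordAlgebra (form a (v.adicCompletion F))) s =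
      c • cliffordMap (v.adicCompletionIntegers F) (v.adicCompletion F) a w) :
    ∃ d : v.adicCompletionIntegers F, s = c * d := by
  have h2K : (2 : v.adicCompletion F) ≠ 0 := by
    rw [← map_ofNat (algebraMap F (v.adicCompletion F)) 2]
    simpa using h2
  obtain ⟨d, hd⟩ := exists_algebraMap_eq_of_algebraMap_eq_cliffordMap a h2K (s := c⁻¹ * s) (w := w)
    (by rw [map_mul, h, ← Algebra.smul_def, smul_smul, inv_mul_cancel₀ hc, one_smul])
  refine ⟨d, ?_⟩
  rw [← mul_inv_cancel_left₀ hc s, ← hd]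
  rfl

end Local

end DiagLattice

/-- The conjugate of `x` is `(p² - r² m) x - 2 p r y`. Its first term anticommutes with `y`, and the
second contributes `-4 p r y²`. -/
theorem rotation_conj_anticommutator {A C : Type*} [CommRing A] [Ring C] [Algebra A C] {x y : C}
    {m : A} (hx : x * x = 1) (hy : y * y = algebraMap A C m) (hyx : y * x = -(x * y)) (p r : A) :
    (p • 1 + r • (x * y)) * x * (p • 1 - r • (x * y)) * y +
      y * ((p • 1 + r • (x * y)) * x * (p • 1 - r • (x * y))) =
      algebraMap A C (-(4 * p * r * m)) := by
  have hx' (z : C) : x * (x * z) = z := by rw [← mul_assoc, hx, one_mul]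
  have hyx' (z : C) : y * (x * z) = -(x * (y * z)) := by
    rw [← mul_assoc, hyx, neg_mul, mul_assoc]
  rw [Algebra.algebraMap_eq_smul_one] at hy ⊢
  simp only [add_mul, mul_add, sub_mul, mul_sub, smul_mul_assoc, mul_smul_comm, mul_assoc, one_mul,
    mul_one, neg_mul, hy, hyx, hx', hyx', mul_neg, neg_neg, smul_neg, smul_add]
  module

/-! ### The action of spin elements on `V` and the failure of strong approximation. -/

namespace DiagLattice

section Conj

variable {R : Type*} [CommRing R] {ι : Type*} [Fintype ι] [DecidableEq ι] (a : ι → R)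

/-- Twice the inner product of the conjugate of `v_i` by `z` with `v_j`, for `z` in the spin
group. -/
def conjPairing (A : Type*) [CommRing A] [Algebra R A] (i j : ι) (z : CliffordAlgebra (form a A)) :
    CliffordAlgebra (form a A) :=
  z * gen a A i * star z * gen a A j + gen a A j * (z * gen a A i * star z)

theorem star_gen (A : Type*) [CommRing A] [Algebra R A] (i : ι) :
    star (gen a A i) = -gen a A i := CliffordAlgebra.star_ι _

theorem cliffordMap_conjPairing (A B : Type*) [CommRing A] [Algebra R A] [CommRing B] [Algebra R B]
    [Algebra A B] [IsScalarTower R A B] (i j : ι) (z : CliffordAlgebra (form a A)) :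
    cliffordMap A B a (conjPairing a A i j z) = conjPairing a B i j (cliffordMap A B a z) := by
  simp only [conjPairing, map_add, map_mul, cliffordMap_gen, star_cliffordMap]

/-- Over the local integers this says that the pairing depends modulo `c` only on the element modulo
`c`. -/
theorem exists_conjPairing_add_smul (A : Type*) [CommRing A] [Algebra R A] (i j : ι) (c : A)
    (z w : CliffordAlgebra (form a A)) :
    ∃ u, conjPairing a A i j (z + c • w) = conjPairing a A i j z + c • u := by
  refine ⟨w * gen a A i * star (z + c • w) * gen a A j + z * gen a A i * star w * gen a A j +
    gen a A j * (w * gen a A i * star (z + c • w)) + gen a A j * (z * gen a A i * star w), ?_⟩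
  simp only [conjPairing, star_add, CliffordAlgebra.star_smul, add_mul, mul_add, smul_mul_assoc,
    mul_smul_comm, smul_add]
  abel

/-- The spin group acts on the quadratic space by isometries. -/
theorem exists_conjPairing_eq {K : Type*} [Field K] [Algebra R K] (h2 : (2 : K) ≠ 0)
    {z : CliffordAlgebra (form a K)} (hz : z ∈ spinGroup (form a K)) (i : ι) :
    ∃ y : ι → K, form a K y = algebraMap R K (a i) ∧
      ∀ j, conjPairing a K i j z = algebraMap K _ (2 * (algebraMap R K (a j) * y j)) := by
  let := invertibleOfNonzero h2
  let u : (CliffordAlgebra (form a K))ˣ :=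
    ⟨z, star z, spinGroup.mul_star_self_of_mem hz, spinGroup.star_mul_self_of_mem hz⟩
  obtain ⟨y, hy⟩ := spinGroup.conjAct_smul_ι_mem_range_ι (x := u) hz (Pi.single i 1)
  replace hy : CliffordAlgebra.ι (form a K) y = z * gen a K i * star z := hy
  refine ⟨y, ?_, fun j => ?_⟩
  · apply (algebraMap K (CliffordAlgebra (form a K))).injective
    rw [← CliffordAlgebra.ι_sq_scalar, hy]
    have : z * gen a K i * star z * (z * gen a K i * star z) =
      z * (gen a K i * ((star z * z) * (gen a K i * star z))) := by simp only [mul_assoc]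
    rw [this, spinGroup.star_mul_self_of_mem hz, one_mul, ← mul_assoc (gen a K i), gen_mul_self,
      ← mul_assoc, ← Algebra.commutes, mul_assoc, spinGroup.mul_star_self_of_mem hz, mul_one]
  · rw [conjPairing, ← hy, gen, CliffordAlgebra.ι_mul_ι_add_swap, polar_form_single]

end Conj

variable {k : Type*} [Field k] {t : k} {g : k[X]}

/-- An integral rotation of the plane of `v₁` and `v₃`, the square of the product of the reflections
in `v₁` and `v₁ + v₃`, when `1 + xt` is a unit. -/
theorem exists_mem_spinGroup_conjPairing (A : Type*) [CommRing A] [Algebra k[X] A] {n : A}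
    (hn : algebraMap k[X] A (1 + .X * .C t) * n = 1) :
    ∃ z ∈ spinGroup (form (entries t g) A), conjPairing (entries t g) A 0 2 z =
      algebraMap A _ (-(8 * n ^ 2 * algebraMap k[X] A ((1 - .X * .C t) * (.X * .C t)))) := by
  set a := entries t g
  set m := algebraMap k[X] A (.X * .C t) with hm
  have hnm : (1 + m) * n = 1 := by
    rwa [map_add, map_one] at hn
  let e : Fin 4 → A := Pi.single 0 1
  let f : Fin 4 → A := Pi.single 0 1 + Pi.single 2 1
  have he : form a A e = 1 := by rw [form_single]; simp [a]
  have hf : form a A f = 1 + m := by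
    rw [form_apply, Fin.sum_univ_four]
    simp [f, a, hm]
  have hnf : form a A (n • f) = n := by
    rw [QuadraticMap.map_smul, hf, smul_eq_mul]
    linear_combination n * hnm
  have hx : gen a A 0 * gen a A 0 = 1 := by rw [gen_mul_self]; simp [a]
  have hy : gen a A 2 * gen a A 2 = algebraMap A _ m := by rw [gen_mul_self]; simp [a, hm]
  have hyx : gen a A 2 * gen a A 0 = -(gen a A 0 * gen a A 2) :=
    gen_mul_gen_of_ne a A (by decide)
  have hιf : CliffordAlgebra.ι (form a A) f = gen a A 0 + gen a A 2 := map_add _ _ _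
  -- With `x, y` the generators of `v₁, v₃`, the product is `n (1 + xy)²`, and `(xy)² = -m`. The
  -- scaling of the last vector by `n = (1 + m)⁻¹` normalizes the product of the four values of `Q`
  -- to `1`.
  have hprod : CliffordAlgebra.ι (form a A) e * CliffordAlgebra.ι (form a A) f *
      (CliffordAlgebra.ι (form a A) e * CliffordAlgebra.ι (form a A) (n • f)) =
      (n * (1 - m)) • 1 + (2 * n) • (gen a A 0 * gen a A 2) := by
    have hxy : gen a A 0 * gen a A 2 * (gen a A 0 * gen a A 2) = -(m • 1) := by
      rw [mul_assoc, ← mul_assoc (gen a A 2), hyx, neg_mul, mul_assoc, hy, mul_neg, ← mul_assoc,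
        hx, one_mul, Algebra.algebraMap_eq_smul_one]
    rw [map_smul, hιf]
    change gen a A 0 * _ * (gen a A 0 * _) = _
    rw [mul_smul_comm, mul_smul_comm, mul_add, hx, add_mul, mul_add, mul_add, hxy]
    simp only [one_mul, mul_one]
    module
  refine ⟨_, ι_mul_ι_mul_ι_mem_spinGroup (w := e) (x := f) (y := e) (z := n • f) (by simp [he])
    (by rw [hf]; exact IsUnit.of_mul_eq_one _ hnm) (by simp [he])
    (by rw [hnf]; exact IsUnit.of_mul_eq_one _ ((mul_comm _ _).trans hnm))
    (by rw [he, hf, hnf]; linear_combination hnm), ?_⟩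
  rw [hprod]
  have hstar : star ((n * (1 - m)) • (1 : CliffordAlgebra (form a A)) +
      (2 * n) • (gen a A 0 * gen a A 2)) =
      (n * (1 - m)) • 1 - (2 * n) • (gen a A 0 * gen a A 2) := by
    rw [star_add, CliffordAlgebra.star_smul, CliffordAlgebra.star_smul, star_mul, star_gen,
      star_gen, neg_mul_neg, hyx, star_one, smul_neg, ← sub_eq_add_neg]
  rw [conjPairing, hstar, rotation_conj_anticommutator hx hy hyx]
  congr 1
  rw [map_mul, map_sub, map_one, ← hm]
  ring

/-- An element of `Spin(V)(F)` integral at all places acts trivially on the third coordinate of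
`v₁`. -/
theorem conjPairing_eq_zero (h2 : (2 : k) ≠ 0) (ht : ¬ IsSquare t) (hg : g.Monic)
    (hgeven : Even g.natDegree) (hgdeg : 1 < g.natDegree)
    (F : Type*) [Field F] [Algebra k[X] F] [IsFractionRing k[X] F]
    {z : CliffordAlgebra (form (entries t g) F)} (hz : z ∈ spinGroup (form (entries t g) F))
    (hint : ∀ v : HeightOneSpectrum k[X], cliffordMap F (v.adicCompletion F) (entries t g) z ∈
      Set.range (cliffordMap (v.adicCompletionIntegers F) (v.adicCompletion F) (entries t g))) :
    conjPairing (entries t g) F 0 2 z = 0 := by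
  have hinj := IsFractionRing.injective k[X] F
  have h2F : (2 : F) ≠ 0 := by
    rw [← map_ofNat (algebraMap k[X] F) 2, Ne, map_eq_zero_iff _ hinj, ← Polynomial.C_ofNat]
    simpa using h2
  obtain ⟨y, hy1, hy⟩ := exists_conjPairing_eq (entries t g) h2F hz 0
  -- The pairings `2 aⱼ yⱼ` are scalars lying in every local lattice, hence integral at every place,
  -- hence polynomials; `2` is a unit of `k`.
  have hR (j : Fin 4) : ∃ b : k[X],
      algebraMap k[X] F b = algebraMap k[X] F (entries t g j) * y j := by
    obtain ⟨b, hb⟩ := HeightOneSpectrum.mem_integers_of_valuation_le_one F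
      (2 * (algebraMap k[X] F (entries t g j) * y j)) fun v => by
        obtain ⟨w, hw⟩ := hint v
        have h := congrArg (cliffordMap F (v.adicCompletion F) (entries t g)) (hy j)
        rw [cliffordMap_conjPairing, ← hw, ← cliffordMap_conjPairing, AlgHom.commutes,
          IsScalarTower.algebraMap_apply F (v.adicCompletion F)
            (CliffordAlgebra (form (entries t g) (v.adicCompletion F)))] at h
        obtain ⟨d, hd⟩ := exists_eq_mul_of_algebraMap_eq h2F one_ne_zero
          (h.symm.trans (one_smul _ _).symm)
        rw [← HeightOneSpectrum.valuedAdicCompletion_eq_valuation' v]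
        refine le_of_eq_of_le (congrArg Valued.v (hd.trans (one_mul _))) d.2
    refine ⟨Polynomial.C (2⁻¹ : k) * b, mul_left_cancel₀ h2F ?_⟩
    have h2C : (2 : k[X]) * .C 2⁻¹ = 1 := by
      rw [← Polynomial.C_ofNat, ← Polynomial.C_mul, ← Polynomial.C_1]
      exact congrArg _ (mul_inv_cancel₀ h2)
    rw [← hb, ← map_ofNat (algebraMap k[X] F) 2, ← map_mul, ← mul_assoc, h2C, one_mul]
  choose b hb using hR
  have ht0 : t ≠ 0 := by rintro rfl; exact ht IsSquare.zero
  -- This is `Q(y) = 1` multiplied by `x g`, after substituting `yⱼ = bⱼ / aⱼ`.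
  have hpoly : Polynomial.X * g * (b 0 ^ 2 - Polynomial.C t * (Polynomial.C t⁻¹ * b 1) ^ 2) +
      Polynomial.C t * (g * (Polynomial.C t⁻¹ * b 2) ^ 2) - b 3 ^ 2 = Polynomial.X * g := by
    apply hinj
    have htF : algebraMap k[X] F (.C t) * algebraMap k[X] F (.C t⁻¹) = 1 := by
      rw [← map_mul, ← Polynomial.C_mul, mul_inv_cancel₀ ht0, Polynomial.C_1, map_one]
    rw [form_entries] at hy1
    simp only [map_add, map_sub, map_mul, map_pow, hb]
    simp only [entries, Matrix.cons_val, map_neg, map_mul, map_one] at hy1 ⊢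
    linear_combination algebraMap k[X] F .X * algebraMap k[X] F g * hy1 +
      (algebraMap k[X] F (.C t) * algebraMap k[X] F (.C t⁻¹) + 1) *
      (algebraMap k[X] F (.C t) * algebraMap k[X] F g * algebraMap k[X] F .X ^ 2 * y 2 ^ 2 -
        algebraMap k[X] F .X * algebraMap k[X] F g * algebraMap k[X] F (.C t) * y 1 ^ 2) * htF
  have h0 := Polynomial.eq_zero_of_form_eq_one ht hg hgeven hgdeg hpoly
  have hb2 : b 2 = 0 := by simpa [ht0] using h0
  rw [hy, ← hb, hb2, map_zero, mul_zero, map_zero]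

theorem not_spinStrongApproximation (h2 : (2 : k) ≠ 0) (ht : ¬ IsSquare t) (hg : g.Monic)
    (hgeven : Even g.natDegree) (hgdeg : 1 < g.natDegree)
    (F : Type*) [Field F] [Algebra k[X] F] [IsFractionRing k[X] F] :
    ¬ SpinStrongApproximation F (entries t g) := by
  classical
  intro hdense
  have ht0 : t ≠ 0 := by rintro rfl; exact ht IsSquare.zero
  have hinj := IsFractionRing.injective k[X] F
  have h2F : (2 : F) ≠ 0 := by
    rw [← map_ofNat (algebraMap k[X] F) 2, Ne, map_eq_zero_iff _ hinj, ← Polynomial.C_ofNat]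
    simpa using h2
  let q : HeightOneSpectrum k[X] := ⟨Ideal.span {.X}, by
    rw [Ideal.span_singleton_prime Polynomial.X_ne_zero]
    exact Polynomial.prime_X, by simp⟩
  have hunit {f : k[X]} (hf : f.eval 0 ≠ 0) :
      IsUnit (algebraMap k[X] (q.adicCompletionIntegers F) f) := by
    rw [HeightOneSpectrum.isUnit_algebraMap_iff, Ideal.mem_span_singleton, Polynomial.X_dvd_iff,
      Polynomial.coeff_zero_eq_eval_zero]
    exact hf
  obtain ⟨n, hn⟩ := (hunit (f := 1 + .X * .C t) (by simp)).exists_right_inv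
  obtain ⟨z, hz, hzp⟩ := exists_mem_spinGroup_conjPairing (g := g) _ hn
  let K := q.adicCompletion F
  let φ := cliffordMap (q.adicCompletionIntegers F) K (entries t g)
  let x : q.adicCompletionIntegers F := algebraMap k[X] _ Polynomial.X
  have hx : x ≠ 0 := by
    rw [Ne, map_eq_zero_iff _ (FaithfulSMul.algebraMap_injective _ _)]
    exact Polynomial.X_ne_zero
  -- Precision `x²` suffices because the pairing of the local rotation has order exactly one at `x`.
  let c : K := algebraMap (q.adicCompletionIntegers F) K (x ^ 2)
  have hc : c ≠ 0 := by
    rw [Ne, map_eq_zero_iff _ (FaithfulSMul.algebraMap_injective _ _)]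
    exact pow_ne_zero 2 hx
  let γ : LocalSpin F (entries t g) q := ⟨φ z, cliffordMap_mem_spinGroup _ _ (entries t g) hz⟩
  -- The adelic point to be approximated: the rotation at `x`, the identity at all other places. It
  -- shows that the open set `U` is nonempty.
  let α : ∀ v, LocalSpin F (entries t g) v := Function.update (fun v => ⟨1, one_mem _⟩) q γ
  have hαq : α q = γ := Function.update_self _ _ _
  have hα (v) : α v ∈ integralSpin F (entries t g) v := by
    rcases eq_or_ne v q with rfl | hv
    · rw [hαq]
      exact ⟨z, rfl⟩
    · rw [show α v = ⟨1, one_mem _⟩ from Function.update_of_ne hv _ _]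
      exact ⟨1, map_one _⟩
  let U : Set (AdelicSpin F (entries t g)) := {β | ∀ v, β.1 v ∈ integralSpin F (entries t g) v} ∩
    {β | (β q).1 ∈ {x | ∃ w, x - φ z = c • φ w}}
  have hU : IsOpen U := by
    refine (RestrictedProduct.isOpen_forall_mem
      fun v => isOpen_integralSpin F (entries t g) v).inter ?_
    have h1 : IsOpen {x : LocalSpin F (entries t g) q | ∃ w, x.1 - φ z = c • φ w} := by
      let := moduleTopology K (CliffordAlgebra (form (entries t g) K))
      have := IsModuleTopology.topologicalAddGroup K (CliffordAlgebra (form (entries t g) K))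
      exact ⟨_, (isOpen_smul_range_cliffordMap F (entries t g) q hc).preimage
        (continuous_id.sub continuous_const : Continuous fun x => x - φ z), rfl⟩
    exact h1.preimage (RestrictedProduct.continuous_eval q)
  obtain ⟨δ, hδ, w, hw⟩ := hdense.exists_mem_open hU
    ⟨⟨α, Filter.Eventually.of_forall hα⟩, hα, 0, by
      change (α q).1 - φ z = _
      rw [hαq, map_zero, smul_zero]
      exact sub_self _⟩
  have h0 := conjPairing_eq_zero h2 ht hg hgeven hgdeg F δ.2 hδ
  replace h0 := congrArg (cliffordMap F K (entries t g)) h0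
  have hδq : cliffordMap F K (entries t g) δ.1 = φ (z + x ^ 2 • w) := by
    rw [map_add, cliffordMap_smul]
    exact sub_eq_iff_eq_add'.1 hw
  obtain ⟨u, hu⟩ := exists_conjPairing_add_smul (entries t g) (q.adicCompletionIntegers F) 0 2
    (x ^ 2) z w
  rw [map_zero, cliffordMap_conjPairing, hδq, ← cliffordMap_conjPairing, hu, hzp, map_add,
    cliffordMap_smul, cliffordMap_algebraMap, map_neg, map_neg, neg_add_eq_zero] at h0
  obtain ⟨d, hd⟩ := exists_eq_mul_of_algebraMap_eq h2F hc h0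
  have hd' : 8 * n ^ 2 * algebraMap k[X] (q.adicCompletionIntegers F)
      ((1 - .X * .C t) * (.X * .C t)) = x ^ 2 * d := Subtype.ext hd
  -- Cancelling one factor `x` leaves a unit at `x` on the left, since `2`, `t`, `n` and `1 - xt`
  -- are units there, and a multiple of `x` on the right.
  have hxd : n ^ 2 * algebraMap k[X] (q.adicCompletionIntegers F)
      (.C (2 * 2 * 2) * ((1 - .X * .C t) * .C t)) = x * d := by
    refine mul_left_cancel₀ hx ?_
    simp only [map_mul, map_ofNat] at hd' ⊢
    linear_combination hd'
  have hn' : IsUnit n := IsUnit.of_mul_eq_one _ ((mul_comm _ _).trans hn)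
  have hxu : IsUnit x := isUnit_of_mul_isUnit_left
    (hxd ▸ (hn'.pow 2).mul (hunit (by simp [h2, ht0])))
  rw [HeightOneSpectrum.isUnit_algebraMap_iff] at hxu
  exact hxu (Ideal.mem_span_singleton_self _)

end DiagLattice

end

theorem theorem4p2 {k : Type*} [Field k] (hchar : (2 : k) ≠ 0) (hk : IsC1Field k)
    (t : k) (ht : ¬ IsSquare t) (g : k[X]) (hg : g.Monic) (hgeven : Even g.natDegree)
    (hgdeg : 1 < g.natDegree) (hg0 : g.eval 0 = 1)
    (L : Fin 4 → k[X])
    (hL : L = ![1, -Polynomial.C t, Polynomial.X * Polynomial.C t, -(Polynomial.X * g)]) :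
    DiagLattice.IsUniversalOver L (RatFunc k) ∧
    (∀ v : HeightOneSpectrum k[X], DiagLattice.IsLocallyUniversalAt (RatFunc k) L v) ∧
    ¬ DiagLattice.RepresentsOver L Polynomial.X k[X] ∧
    ¬ DiagLattice.HassePrinciple (RatFunc k) (fun _ : Unit => (Polynomial.X : k[X])) L ∧
    ¬ DiagLattice.SpinStrongApproximation (RatFunc k) L := by
  subst hL
  exact ⟨DiagLattice.isUniversalOver_fractionField hchar hk ht hg.ne_zero _,
    DiagLattice.isLocallyUniversalAt hchar hk ht hg0 _,
    DiagLattice.not_representsOver_X ht hg hgeven hgdeg,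
    DiagLattice.not_hassePrinciple hchar hk ht hg hgeven hgdeg hg0 _,
    DiagLattice.not_spinStrongApproximation hchar ht hg hgeven hgdeg _⟩
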